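/- Let $m,M\ge 1$ be integers and $v_e,\tilde v_e>0$. A torus is cut into $2M$ consecutive cylinders $X_1,\dots,X_{2M}$ (indices mod $2M$) whose boundary circles have length $L$; interface $i$ joins the right edge of $X_{i-1}$ to the left edge of $X_i$. The Hilbert space is the tensor product of the cylinder spaces, which have the orthonormal occupation-number bases described below. *Laughlin state.* The sectors are $a\in\{0,\dots,m-1\}$. An edge basis state is $\mathcal N=(N,\{n_k\})$ with $N\in\mathbb Z-\frac am$ and boson numbers $n_k\in\{0,1,2,\dots\}$, almost all zero, $k\in\frac{2\pi}{L}\{1,2,\dots\}$. A cylinder basis state is a pair of edge states. With $$\lambda(\mathcal N)=\exp\Big[-\tfrac{v_e\pi m}{2L}N^2-\sum_{k>0}\tfrac{v_ek}{2}n_k\Big],\qquad |\Psi_a\rangle=\bigotimes_{i=1}^{2M}\sum_{\mathcal N_i\text{ in sector }a}\lambda(\mathcal N_i)\,|\mathcal N_i\rangle_{RX_{i-1}}\otimes|\mathcal N_i\rangle_{LX_i}.$$ Put $d_a=1$ and $\alpha=\frac{\pi}{2v_e}$. *Moore–Read state.* The sectors are $e^{ir\phi}$, $\chi e^{ir\phi}$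 (untwisted) and $\xi e^{i(r+1/2)\phi}$ (twisted), $r\in\{0,\dots,m-1\}$. An edge basis state is $\mathcal N=(N,\{n_k\},\{\tilde n_k\})$ with $N=n-\frac rm$ (untwisted) or $N=n-\frac{r+1/2}{m}$ (twisted), $n\in\mathbb Z$, boson numbers $n_k$ as before, and fermion numbers $\tilde n_k\in\{0,1\}$, almost all zero, with $k\in\frac{2\pi}{L}\{\frac12,\frac32,\dots\}$ (untwisted) or $k\in\frac{2\pi}{L}\{1,2,\dots\}$ (twisted). Let $$\lambda(\mathcal N)=\exp\Big[-\tfrac{v_e\pi m}{2L}N^2-\sum_{k>0}\tfrac{v_ek}{2}n_k-\sum_{k>0}\tfrac{\tilde v_ek}{2}\tilde n_k\Big],\qquad |\hat\Psi_{i}\rangle=\sum_{\mathcal N_i}i^{\sum_k\tilde n_{i,k}}\lambda(\mathcal N_i)\,|\mathcal N_i\rangle_{RX_{i-1}}\otimes|\mathcal N_i\rangle_{LX_i},$$ where in the prefactor $i^{\sum_k \tilde n_{i,k}}$ the base is the imaginary unit. In an untwisted sector $|\Psi_a\rangle$ is the projection of $\bigotimes_i|\hat\Psi_i\rangle$ to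 the terms in which, at every interface, $n_i+\sum_k\tilde n_{i,k}$ is even (for $e^{ir\phi}$), respectively odd (for $\chi e^{ir\phi}$). In a twisted sector each cylinder carries in addition a zero-mode occupation number $\gamma_i\in\{0,1\}$, and $|\Psi_a\rangle$ is the projection of $\bigotimes_i|\hat\Psi_i\rangle\otimes 2^{-(2M-1)/2}\sum_{\sum_i\gamma_i\text{ odd}}|\gamma_1\cdots\gamma_{2M}\rangle$ to the terms in which, for every $i$, $-N_i+N_{i+1}+\sum_k(\tilde n_{i,k}+\tilde n_{i+1,k})+\gamma_i+\delta_{i,2M}$ is even. Put $d_a=1$ in the untwisted and $d_a=\sqrt2$ in the twisted sectors, and $\alpha=\frac\pi2\big(\frac1{v_e}+\frac1{2\tilde v_e}\big)$. In both cases let $\mathcal D=\sqrt{\sum_a d_a^2}$, let $\psi_a\in\mathbb C$ satisfy $\sum_a|\psi_a|^2=1$, and let $|\Psi\rangle=\sum_a\psi_a|\Psi_a\rangle/\|\Psi_a\|$. For a density matrix $\rho$ on a set of cylinders let $\mathcal E(\rho)=\log\|\rho^{T_{\rm odd}}\|_1$ be the entanglement negativity between its odd and its even cylinders, where $T_{\rm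 odd}$ is the partial transpose, in the basis above, on the odd cylinders, and $\|T\|_1=\operatorname{tr}\sqrt{T^\dagger T}$. Then $\mathcal D=\sqrt m$ for Laughlin and $\mathcal D=\sqrt{4m}$ for Moore–Read; for every $L>0$ the vector $|\Psi\rangle$ is a well-defined unit vector and the partial transposes below are trace class; and for fixed $m,M,v_e,\tilde v_e,\psi$, as $L\to\infty$: 1. (Torus) $\displaystyle \mathcal E(|\Psi\rangle\langle\Psi|)=M\alpha L-M\log\mathcal D^2+2\log\sum_a|\psi_a|\,d_a^{M}+o(1).$ 2. (Cylinder) For every set $\bar Y$ of $N$ cylinders with $1\le N\le M$, with $R$ the number of interfaces both of whose adjacent cylinders are not in $\bar Y$, $$\mathcal E(\operatorname{Tr}_{\bar Y}|\Psi\rangle\langle\Psi|)=\tfrac R2\alpha L-\tfrac R2\log\mathcal D^2+\log\sum_a|\psi_a|^2d_a^{R}+o(1).$$ -/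

import Mathlib

open scoped InnerProductSpace ComplexConjugate

noncomputable section

namespace CutGlue

/-! ### Matrix elements, partial trace, partial transpose, entanglement negativity

The subsystems are labelled by `ι`, each has an orthonormal (occupation number) basis labelled by `B`,
and the total Hilbert space is `ℓ²(ι → B)`. Density matrices are given by their matrix elements in the
product basis. -/

/-- The Hilbert space with orthonormal basis labelled by `κ`. -/
abbrev Hilb (κ : Type) : Type := lp (fun _ : κ => ℂ) 2

open scoped Classical in
/-- The basis vector `|x⟩`. -/
def ket {κ : Type} (x : κ) : Hilb κ := lp.single 2 x (1 : ℂ)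

/-- `T` is the bounded operator with matrix elements `⟨x|T|y⟩ = K x y`. -/
def HasMatrix {κ : Type} (T : Hilb κ →L[ℂ] Hilb κ) (K : κ → κ → ℂ) : Prop :=
  ∀ x y, ⟪ket x, T (ket y)⟫_ℂ = K x y

/-- The absolute value `√(T† T)` of a bounded operator. -/
def opAbs {H : Type} [NormedAddCommGroup H] [InnerProductSpace ℂ H] [CompleteSpace H]
    (T : H →L[ℂ] H) : H →L[ℂ] H := CFC.abs T

/-- `T` is trace class with trace norm `‖T‖₁ = tr √(T† T) = t`. -/
def HasTraceNorm {κ : Type} (T : Hilb κ →L[ℂ] Hilb κ) (t : ℝ) : Prop :=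
  HasSum (fun x : κ => ⟪ket x, opAbs T (ket x)⟫_ℂ) (t : ℂ)

/-- Matrix elements of `|Ψ⟩⟨Ψ|`. -/
def pureDensity {κ : Type} (Ψ : κ → ℂ) (x y : κ) : ℂ := Ψ x * conj (Ψ y)

/-- Matrix elements of the reduced density matrix `Tr_S K`, on the subsystems outside `S`. -/
def partialTrace {ι B : Type} [DecidableEq ι] (S : Finset ι)
    (K : (ι → B) → (ι → B) → ℂ) (x y : {i // i ∉ S} → B) : ℂ :=
  ∑' z : {i // i ∈ S} → B,
    K (fun i => if h : i ∈ S then z ⟨i, h⟩ else x ⟨i, h⟩)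
      (fun i => if h : i ∈ S then z ⟨i, h⟩ else y ⟨i, h⟩)

/-- Matrix elements of the partial transpose with respect to the subsystems in `A`:
`⟨i_A j_B| K^{T_A} |k_A l_B⟩ = ⟨k_A j_B| K |i_A l_B⟩`. -/
def partialTranspose {ι B : Type} (A : ι → Prop) [DecidablePred A]
    (K : (ι → B) → (ι → B) → ℂ) (x y : ι → B) : ℂ :=
  K (fun i => if A i then y i else x i) (fun i => if A i then x i else y i)

/-- The density matrix `K` has (logarithmic) entanglement negativity `log ‖K^{T_A}‖₁ = E` between
the subsystems in `A` and the remaining ones. The partial transpose is required to be a bounded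
operator of trace class, with nonzero trace norm. -/
def HasNegativity {ι B : Type} (A : ι → Prop) [DecidablePred A]
    (K : (ι → B) → (ι → B) → ℂ) (E : ℝ) : Prop :=
  ∃ T : Hilb (ι → B) →L[ℂ] Hilb (ι → B), HasMatrix T (partialTranspose A K) ∧
    ∃ t : ℝ, 0 < t ∧ HasTraceNorm T t ∧ E = Real.log t

/-! ### Geometry

The cylinders are `X_i`, `i : ZMod (2 * M)`, so that the residues `1, …, 2M - 1, 0` stand for
`X_1, …, X_{2M}`; interface `i` lies between the right edge of `X_{i-1}` and the left edge of `X_i`. -/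

/-- `X_i` is one of the odd cylinders. -/
def IsOdd {M : ℕ} (i : ZMod (2 * M)) : Prop := Odd i.val

instance {M : ℕ} : DecidablePred (IsOdd (M := M)) :=
  fun i => inferInstanceAs (Decidable (Odd i.val))

/-- The number of interfaces shared by two cylinders not in `S`. -/
def sharedInterfaces {M : ℕ} [NeZero M] (S : Finset (ZMod (2 * M))) : ℕ :=
  (Finset.univ.filter fun i : ZMod (2 * M) => i - 1 ∉ S ∧ i ∉ S).card

/-- The general torus state `∑_a ψ_a |Ψ_a⟩ / ‖Ψ_a‖`, for unnormalized sector states `Ψ_a`. -/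
def superpose {κ A : Type} [Fintype A] (Ψ : A → κ → ℂ) (ψ : A → ℂ) (x : κ) : ℂ :=
  ∑ a, ψ a * (Ψ a x / (Real.sqrt (∑' y, ‖Ψ a y‖ ^ 2) : ℂ))

/-- The total quantum dimension `𝒟 = √(∑_a d_a²)`. -/
def totalDim {A : Type} [Fintype A] (d : A → ℝ) : ℝ := Real.sqrt (∑ a, d a ^ 2)

/-- The energy `∑_{k>0} k n_k` of bosons with occupation number `n j` in the mode
`k = 2π(j+1)/L`, `j = 0, 1, 2, …`. -/
def bosonEnergy (L : ℝ) (n : ℕ →₀ ℕ) : ℝ :=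
  n.sum fun j nj => 2 * Real.pi * (j + 1) / L * nj

/-! ### The Laughlin state at filling `1/m` -/

/-- The collective mode number `𝒩 = (N, {n_k})` of an edge: `N = n - a/m` with `a` the anyon flux,
and bosonic occupation numbers. On a left edge, `N` is minus the winding number. -/
structure LaughlinEdge (m : ℕ) : Type where
  flux : Fin m
  n : ℤ
  boson : ℕ →₀ ℕ

/-- Basis states of a cylinder. -/
structure LaughlinCyl (m : ℕ) : Type where
  left : LaughlinEdge m
  right : LaughlinEdge m

/-- The charge `N = n - a/m`. -/
def LaughlinEdge.charge {m : ℕ} (e : LaughlinEdge m) : ℝ := e.n - (e.flux : ℝ) / m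

/-- `λ(𝒩) = exp[-(v π m / 2L) N² - ∑_k (v k / 2) n_k]`. The (divergent, to be regularized)
zero-point energy is a factor independent of `𝒩`, which drops out of the normalized state. -/
def LaughlinEdge.weight {m : ℕ} (v L : ℝ) (e : LaughlinEdge m) : ℝ :=
  Real.exp (-(v * Real.pi * m / (2 * L)) * e.charge ^ 2 - v / 2 * bosonEnergy L e.boson)

open scoped Classical in
/-- Amplitudes of the interface state `∑_𝒩 λ(𝒩) |𝒩⟩_{RX_{i-1}} ⊗ |𝒩⟩_{LX_i}` in sector `a`. -/
def laughlinInterface {m : ℕ} (v L : ℝ) (a : Fin m) (R K : LaughlinEdge m) : ℂ :=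
  if R = K ∧ K.flux = a then (K.weight v L : ℂ) else 0

/-- The unnormalized torus ground state in sector `a`. -/
def laughlinSector {m : ℕ} (M : ℕ) [NeZero M] (v L : ℝ) (a : Fin m)
    (X : ZMod (2 * M) → LaughlinCyl m) : ℂ :=
  ∏ i, laughlinInterface v L a (X (i - 1)).right (X i).left

/-- The torus state with amplitudes `ψ_a`. -/
def laughlinState {m : ℕ} (M : ℕ) [NeZero M] (v L : ℝ) (ψ : Fin m → ℂ) :
    (ZMod (2 * M) → LaughlinCyl m) → ℂ :=
  superpose (laughlinSector M v L) ψ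

/-- All Laughlin quasiparticles are Abelian. -/
def laughlinDim {m : ℕ} (_ : Fin m) : ℝ := 1

/-! ### The Moore-Read state at filling `1/m` -/

/-- The Ising part of an anyon. -/
inductive IsingLabel : Type
  | one
  | chi
  | xi
deriving DecidableEq

instance : Fintype IsingLabel where
  elems := {IsingLabel.one, IsingLabel.chi, IsingLabel.xi}
  complete x := by cases x <;> decide

/-- The `3m` anyon types: `(one, r) = e^{irφ}`, `(chi, r) = χ e^{irφ}`,
`(xi, r) = ξ e^{i(r+1/2)φ}`. -/
abbrev MRSector (m : ℕ) : Type := IsingLabel × Fin m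

/-- The quantum dimension. -/
def mrDim {m : ℕ} (a : MRSector m) : ℝ :=
  match a.1 with
  | .one => 1
  | .chi => 1
  | .xi => Real.sqrt 2

/-- The collective mode number `𝒩 = (N, {n_k}, {ñ_k})` of an edge: `N = n - r/m` and antiperiodic
fermions in the untwisted case, `N = n - (r + 1/2)/m` and periodic fermions in the twisted case;
`fermion` is the set of occupied modes with `k > 0`. On a left edge, `N` is minus the winding
number. -/
structure MREdge (m : ℕ) : Type where
  twisted : Bool
  r : Fin m
  n : ℤ
  boson : ℕ →₀ ℕ
  fermion : Finset ℕ

/-- Basis states of a cylinder. In the twisted case `gamma` is the occupation number of the Dirac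
fermion formed by the two Majorana zero modes of the cylinder; in the untwisted case there are no zero
modes and `gamma = false`. -/
structure MRCyl (m : ℕ) : Type where
  left : MREdge m
  right : MREdge m
  gamma : Bool

/-- The charge `N`. -/
def MREdge.charge {m : ℕ} (e : MREdge m) : ℝ :=
  e.n - ((e.r : ℝ) + if e.twisted then 1 / 2 else 0) / m

/-- `∑_{k>0} k ñ_k`, where `k = 2π(j+1/2)/L` (untwisted) or `k = 2π(j+1)/L` (twisted),
`j = 0, 1, 2, …`. -/
def MREdge.fermionEnergy {m : ℕ} (L : ℝ) (e : MREdge m) : ℝ :=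
  ∑ j ∈ e.fermion, 2 * Real.pi * (j + if e.twisted then 1 else 1 / 2) / L

/-- `λ(𝒩) = exp[-(v π m / 2L) N² - ∑_k (v k / 2) n_k - ∑_k (v' k / 2) ñ_k]`, up to the constant
zero-point factor. -/
def MREdge.weight {m : ℕ} (v v' L : ℝ) (e : MREdge m) : ℝ :=
  Real.exp (-(v * Real.pi * m / (2 * L)) * e.charge ^ 2 - v / 2 * bosonEnergy L e.boson
    - v' / 2 * e.fermionEnergy L)

/-- The combined charge and fermion parity `n + ∑_k ñ_k` (to be read modulo 2). -/
def MREdge.parity {m : ℕ} (e : MREdge m) : ℤ := e.n + e.fermion.card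

open scoped Classical in
/-- Amplitudes of the unprojected interface state
`∑_𝒩 i^{∑ ñ_k} λ(𝒩) |𝒩⟩_{RX_{i-1}} ⊗ |𝒩⟩_{LX_i}` for given boundary conditions. -/
def mrInterface {m : ℕ} (v v' L : ℝ) (twisted : Bool) (r : Fin m) (R K : MREdge m) : ℂ :=
  if R = K ∧ K.twisted = twisted ∧ K.r = r then
    Complex.I ^ K.fermion.card * (K.weight v v' L : ℂ) else 0

/-- The value `1` or `0` of a projector `(1 + (-1)^p)/2`. -/
def parityProj (p : ℤ) : ℂ := if Even p then 1 else 0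

/-- The untwisted sectors: every interface is projected to `n + ∑ ñ_k` even in the sectors
`e^{irφ}` (`p = 0`) and odd in the sectors `χ e^{irφ}` (`p = 1`). -/
def mrUntwisted {m : ℕ} (M : ℕ) [NeZero M] (v v' L : ℝ) (p : ℤ) (r : Fin m)
    (X : ZMod (2 * M) → MRCyl m) : ℂ :=
  ∏ i, mrInterface v v' L false r (X (i - 1)).right (X i).left *
    parityProj ((X i).left.parity + p) * if (X i).gamma then 0 else 1

/-- Amplitudes of the Majorana zero mode state
`2^{-(2M-1)/2} ∑_{γ} |γ_1 … γ_{2M}⟩`, the sum over `γ` with `∑ γ_i` odd. -/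
def majoranaZero (M : ℕ) [NeZero M] (γ : ZMod (2 * M) → Bool) : ℂ :=
  if Odd (∑ i, (γ i).toNat) then ((1 / Real.sqrt (2 ^ (2 * M - 1)) : ℝ) : ℂ) else 0

/-- The exponent of the projector of cylinder `X_i` in the twisted sectors:
`-N_i + N_{i+1} + ∑_k (ñ_{i,k} + ñ_{i+1,k}) + γ_i + u_i`, with `u_i = δ_{i,2M}`. -/
def cylinderParity {m M : ℕ} (i : ZMod (2 * M)) (c : MRCyl m) : ℤ :=
  -c.left.n + c.right.n + (c.left.fermion.card + c.right.fermion.card) + c.gamma.toNat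
    + if i = 0 then 1 else 0

/-- The twisted sectors: the product of the interface states and of the zero mode state, projected on
every cylinder. -/
def mrTwisted {m : ℕ} (M : ℕ) [NeZero M] (v v' L : ℝ) (r : Fin m)
    (X : ZMod (2 * M) → MRCyl m) : ℂ :=
  (∏ i, mrInterface v v' L true r (X (i - 1)).right (X i).left) *
    majoranaZero M (fun i => (X i).gamma) * ∏ i, parityProj (cylinderParity i (X i))

/-- The unnormalized torus ground state in sector `a`. -/
def mrSector {m : ℕ} (M : ℕ) [NeZero M] (v v' L : ℝ) (a : MRSector m) :
    (ZMod (2 * M) → MRCyl m) → ℂ :=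
  match a.1 with
  | .one => mrUntwisted M v v' L 0 a.2
  | .chi => mrUntwisted M v v' L 1 a.2
  | .xi => mrTwisted M v v' L a.2

/-- The torus state with amplitudes `ψ_a`. -/
def mrState {m : ℕ} (M : ℕ) [NeZero M] (v v' L : ℝ) (ψ : MRSector m → ℂ) :
    (ZMod (2 * M) → MRCyl m) → ℂ :=
  superpose (mrSector M v v' L) ψ

/-! ### The asymptotic formulas -/

/-- For a family `Ψ L` of torus states, the negativity between odd and even cylinders is
`M α L - M log 𝒟² + 2 log ∑_a |ψ_a| d_a^M + o(1)` as `L → ∞`. -/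
def TorusFormula {A B : Type} [Fintype A] (M : ℕ) (d : A → ℝ) (ψ : A → ℂ) (α : ℝ)
    (Ψ : ℝ → (ZMod (2 * M) → B) → ℂ) : Prop :=
  ∃ E : ℝ → ℝ, (∀ L > 0, HasNegativity IsOdd (pureDensity (Ψ L)) (E L)) ∧
    Filter.Tendsto (fun L => E L -
      (M * α * L - M * Real.log (totalDim d ^ 2) + 2 * Real.log (∑ a, ‖ψ a‖ * d a ^ M)))
      Filter.atTop (nhds 0)

/-- For a family `Ψ L` of torus states, after tracing over the cylinders in `S` the negativity
between the remaining odd and even cylinders, with `R` shared interfaces, is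
`(R/2) α L - (R/2) log 𝒟² + log ∑_a |ψ_a|² d_a^R + o(1)` as `L → ∞`. -/
def CylinderFormula {A B : Type} [Fintype A] (M : ℕ) [NeZero M] (d : A → ℝ) (ψ : A → ℂ) (α : ℝ)
    (Ψ : ℝ → (ZMod (2 * M) → B) → ℂ) (S : Finset (ZMod (2 * M))) : Prop :=
  ∃ E : ℝ → ℝ,
    (∀ L > 0, HasNegativity (fun i : {i // i ∉ S} => IsOdd i.1)
      (partialTrace S (pureDensity (Ψ L))) (E L)) ∧
    Filter.Tendsto (fun L => E L -
      ((sharedInterfaces S : ℝ) / 2 * α * L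
        - (sharedInterfaces S : ℝ) / 2 * Real.log (totalDim d ^ 2)
        + Real.log (∑ a, ‖ψ a‖ ^ 2 * d a ^ sharedInterfaces S)))
      Filter.atTop (nhds 0)

end CutGlue

end

/-! Every interface label is recorded twice, once in each of the two adjacent cylinders, and one of
these is odd and the other even. If `(p, q)` indexes a nonzero entry of the density matrix, then `p`
on the odd cylinders together with `q` on the even ones therefore determines both `p` and `q`; after
a trace this uses in addition that both extend to configurations agreeing on the traced cylinders.
So the partial transpose has at most one nonzero entry in each row and column, and its trace norm is
the sum of the absolute values of its entries (`exists_hasTraceNorm_of_sparse`,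
`hasNegativity_of_sparse`). Partial transposition only permutes entries, so this is also the
entrywise sum for the density matrix itself.

That sum factorizes over interfaces. Let `α a` and `β a` be the sums of the absolute edge amplitudes
in sector `a` and of their squares, so that the norm of the sector state is a constant times `β a ^
M`. For the torus the trace norm is the square of `∑ ‖ψ a‖ (α a ^ 2 / β a) ^ M`. After a trace, an
interface touching a traced cylinder carries the same label in ket and bra and gives `β a`, while
each of the `R` others gives `α a ^ 2`; the common labels also force a common sector, which leaves
`∑ ‖ψ a‖ ^ 2 (α a ^ 2 / β a) ^ R`. These formulas are exact for every `L > 0`.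

Squaring the weights doubles the velocities, so `α` and `β` are values of one partition sum, a
product of a theta function, a bosonic product and possibly a fermionic product. The modular
transformations of `ModularForm.eta` and of the theta kernel give it the asymptotics `d_a / 𝒟` times
an exponential of `L` (`tendsto_laughlinSum`, `tendsto_mrSum`). Hence `α a ^ 2 / β a` has the same
prefactor `d_a / 𝒟`, and taking logarithms gives both formulas. -/

open scoped InnerProductSpace ComplexConjugate ENNReal

noncomputable section

namespace CutGlue

/-! ### Trace norm of sparse matrices -/

section Operators

variable {κ : Type}

lemma inner_ket_left (x : κ) (f : Hilb κ) : ⟪ket x, f⟫_ℂ = f x := by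
  classical
  simp [ket, lp.inner_single_left]

lemma ket_apply [DecidableEq κ] (x y : κ) : ket x y = if y = x then (1 : ℂ) else 0 := by
  simp only [ket, lp.coeFn_single, Pi.single_apply]
  congr

lemma norm_ket (x : κ) : ‖ket x‖ = 1 := by
  classical
  simp [ket, lp.norm_single]

lemma inner_ket_ket [DecidableEq κ] (x y : κ) : ⟪ket x, ket y⟫_ℂ = if x = y then (1 : ℂ) else 0 := by
  rw [inner_ket_left, ket_apply]

/-- A bounded operator is determined by its values on the basis. -/
lemma operator_ext {H : Type} [NormedAddCommGroup H] [NormedSpace ℂ H]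
    {T U : Hilb κ →L[ℂ] H} (h : ∀ y, T (ket y) = U (ket y)) : T = U := by
  classical
  ext1 f
  have hf : HasSum (fun y => f y • ket y) f := by
    have := lp.hasSum_single (p := 2) (by simp) f
    refine this.congr_fun ?_
    intro y
    rw [ket, ← lp.single_smul]; simp
  have hT := hf.mapL T
  have hU := hf.mapL U
  simp only [map_smul, h] at hT hU
  exact hT.unique hU

/-- The operator `∑ c(x,y) |e(x,y)⟩⟨y|`. -/
def columnOperator (c : κ × κ → ℂ) (e : κ × κ → κ) : Hilb κ →L[ℂ] Hilb κ :=
  ∑' p, c p • InnerProductSpace.rankOne ℂ (ket (e p)) (ket p.2)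

/-- The action of `∑ c(x,y) |e(x,y)⟩⟨y|` on a basis vector. -/
lemma columnOperator_ket {c : κ × κ → ℂ} (hc : Summable fun p => ‖c p‖) (e : κ × κ → κ) (y : κ) :
    HasSum (fun x => c (x, y) • ket (e (x, y))) (columnOperator c e (ket y)) := by
  classical
  have hsum : Summable fun p => c p • InnerProductSpace.rankOne ℂ (ket (e p)) (ket p.2) :=
    Summable.of_norm (hc.congr fun p => by simp [norm_smul, norm_ket])
  have h := hsum.hasSum.mapL (ContinuousLinearMap.apply ℂ (Hilb κ) (ket y))
  have hinj : Function.Injective fun x : κ => (x, y) := fun a b h => by simpa using h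
  rw [← hinj.hasSum_iff] at h
  · refine h.congr_fun fun x => ?_
    simp [inner_ket_ket]
  · rintro ⟨a, b⟩ hab
    have : b ≠ y := fun h => hab ⟨a, by simp [h]⟩
    simp [inner_ket_ket, this]

/-- A kernel with summable entries and at most one nonzero entry in each row and each column is the
matrix of a trace class operator, whose trace norm is the sum of the absolute values. -/
theorem exists_hasTraceNorm_of_sparse (k : κ → κ → ℂ) (t : ℝ)
    (hcol : ∀ x x' y, k x y ≠ 0 → k x' y ≠ 0 → x = x')
    (hrow : ∀ x y y', k x y ≠ 0 → k x y' ≠ 0 → y = y')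
    (ht : HasSum (fun p : κ × κ => ‖k p.1 p.2‖) t) :
    ∃ T : Hilb κ →L[ℂ] Hilb κ, HasMatrix T k ∧ HasTraceNorm T t := by
  classical
  -- `D` is the diagonal operator whose entry at `y` is the sum of the absolute values in column
  -- `y`. It will be the absolute value of `T`: it is positive and `D * D = star T * T`, since
  -- distinct columns of `k` have disjoint supports and are thus orthogonal.
  set T := columnOperator (fun p : κ × κ => k p.1 p.2) Prod.fst with hT
  set D := columnOperator (fun p : κ × κ => (‖k p.1 p.2‖ : ℂ)) Prod.snd with hD
  have hTk : ∀ y, HasSum (fun x => k x y • ket x) (T (ket y)) := fun y =>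
    columnOperator_ket ht.summable Prod.fst y
  have hTm : HasMatrix T k := by
    intro x y
    refine ((hTk y).mapL (innerSL ℂ (ket x))).unique
      ((hasSum_ite_eq x (k x y)).congr_fun fun z => ?_)
    rw [map_smul, innerSL_apply_apply, inner_ket_ket]
    by_cases h : x = z
    · simp [h]
    · simp [h, Ne.symm h]
  set d : κ → ℝ := fun y => ∑' x, ‖k x y‖ with hd
  have hdt : HasSum d t := by
    have h2 : HasSum (fun p : κ × κ => ‖k p.2 p.1‖) t := (Equiv.prodComm κ κ).hasSum_iff.mpr ht
    exact h2.prod_fiberwise fun y => (h2.summable.prod_factor y).hasSum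
  have hDk : ∀ y, D (ket y) = (d y : ℂ) • ket y := by
    intro y
    refine (columnOperator_ket (c := fun p : κ × κ => (‖k p.1 p.2‖ : ℂ))
      (by simpa using ht.summable) Prod.snd y).unique ?_
    have h2 : Summable fun p : κ × κ => ‖k p.2 p.1‖ :=
      ((Equiv.prodComm κ κ).summable_iff.mpr ht.summable :)
    have h3 : HasSum (fun x => (‖k x y‖ : ℂ)) (d y : ℂ) :=
      Complex.hasSum_ofReal.mpr (h2.prod_factor y).hasSum
    exact h3.smul_const (ket y)
  have hDpos : 0 ≤ D := by
    refine tsum_nonneg fun p => ?_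
    rw [ContinuousLinearMap.nonneg_iff_isPositive]
    exact (InnerProductSpace.isPositive_rankOne_self _).smul_of_nonneg
      (by simp)
  have hTy : ∀ x y, k x y ≠ 0 → T (ket y) = k x y • ket x := by
    intro x y hxy
    refine (hTk y).unique ?_
    refine (hasSum_ite_eq x (k x y • ket x : Hilb κ)).congr_fun fun z => ?_
    split_ifs with h
    · rw [h]
    · have : k z y = 0 := by
        by_contra h'
        exact h (hcol _ _ _ h' hxy)
      simp [this]
  have hTy0 : ∀ y, (∀ x, k x y = 0) → T (ket y) = 0 := by
    intro y h0
    refine (hTk y).unique ?_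
    simp [h0]
  have hdy : ∀ x y, k x y ≠ 0 → d y = ‖k x y‖ := by
    intro x y hxy
    refine tsum_eq_single x fun z hz => ?_
    rw [norm_eq_zero]
    by_contra h'
    exact hz (hcol _ _ _ h' hxy)
  have hsq : D * D = star T * T := by
    refine operator_ext fun y => ?_
    refine lp.ext (funext fun z => ?_)
    rw [← inner_ket_left, ← inner_ket_left, mul_apply_eq_comp,
      mul_apply_eq_comp, ContinuousLinearMap.star_eq_adjoint,
      ContinuousLinearMap.adjoint_inner_right, hDk, map_smul, hDk]
    by_cases h0 : ∀ x, k x y = 0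
    · have : d y = 0 := by simp [hd, h0]
      rw [hTy0 y h0, this]; simp
    push Not at h0
    obtain ⟨x, hx⟩ := h0
    rw [hTy x y hx, hdy x y hx]
    by_cases hzy : z = y
    · subst hzy
      rw [hTy x z hx]
      simp only [inner_smul_left, inner_smul_right, inner_ket_ket, if_true, mul_one]
      rw [mul_comm (k x z), ← Complex.normSq_eq_conj_mul_self, Complex.normSq_eq_norm_sq]
      push_cast; ring
    · have hzx : k x z = 0 := by
        by_contra h'
        exact hzy (hrow _ _ _ h' hx)
      rw [inner_smul_right, inner_smul_right, inner_smul_right, inner_ket_ket, if_neg hzy]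
      rw [← inner_conj_symm, inner_ket_left, ← inner_ket_left, hTm, hzx]
      simp
  have habs : opAbs T = D := by
    rw [opAbs, CFC.abs]
    exact CFC.sqrt_unique hsq hDpos
  refine ⟨T, hTm, ?_⟩
  rw [HasTraceNorm, habs]
  refine (Complex.hasSum_ofReal.mpr hdt).congr_fun fun y => ?_
  rw [hDk, inner_smul_right, inner_ket_ket]
  simp

end Operators

/-! ### Negativity of densities with sparse partial transpose -/

section Negativity

variable {ι B Z : Type}

/-- The negativity of the density matrix `∑_z |Ψ_z⟩⟨Ψ_z|` when its partial transpose has at most one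
nonzero entry in each row and column, and the summands have a phase independent of `z`. -/
theorem hasNegativity_of_sparse (A : ι → Prop) [DecidablePred A] (Ψ : (ι → B) → Z → ℂ)
    (K : (ι → B) → (ι → B) → ℂ) (hK : ∀ x y, K x y = ∑' z, Ψ x z * conj (Ψ y z))
    (hphase : ∀ x y, ∃ θ : ℂ, ‖θ‖ = 1 ∧ ∀ z, Ψ x z * conj (Ψ y z) = θ * (‖Ψ x z‖ * ‖Ψ y z‖ : ℝ))
    (hsparse : ∀ p q p' q' z z', Ψ p z ≠ 0 → Ψ q z ≠ 0 → Ψ p' z' ≠ 0 → Ψ q' z' ≠ 0 →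
      (∀ i, A i → p i = p' i) → (∀ i, ¬ A i → q i = q' i) → p = p' ∧ q = q')
    {t : ℝ} (ht : 0 < t)
    (hsum : ∑' x, ∑' y, ∑' z, ‖Ψ x z‖ₑ * ‖Ψ y z‖ₑ = ENNReal.ofReal t) :
    HasNegativity A K (Real.log t) := by
  classical
  -- The common phase `θ` rules out cancellation in the sum over `z`. Convergence comes from the
  -- finiteness of the total sum.
  have hKe : ∀ x y, ‖K x y‖ₑ = ∑' z, ‖Ψ x z‖ₑ * ‖Ψ y z‖ₑ := by
    intro x y
    obtain ⟨θ, hθ, h⟩ := hphase x y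
    have hfin : ∑' z, ‖Ψ x z‖ₑ * ‖Ψ y z‖ₑ ≠ ∞ := by
      refine ne_top_of_le_ne_top ENNReal.ofReal_ne_top
        (hsum ▸ le_trans ?_ (ENNReal.le_tsum x))
      exact ENNReal.le_tsum (f := fun y => ∑' z, ‖Ψ x z‖ₑ * ‖Ψ y z‖ₑ) y
    have hs : Summable fun z => ‖Ψ x z‖ * ‖Ψ y z‖ := by
      have := ENNReal.summable_toReal hfin
      simpa using this
    rw [hK]
    simp only [h]
    rw [tsum_mul_left, ← Complex.ofReal_tsum, enorm_mul, ← ofReal_norm, hθ,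
      ← ofReal_norm, Complex.norm_real, Real.norm_of_nonneg (tsum_nonneg fun z => by positivity),
      ENNReal.ofReal_tsum_of_nonneg (fun z => by positivity) hs]
    simp [ENNReal.ofReal_mul]
  have hK0 : ∀ x y, K x y ≠ 0 → ∃ z, Ψ x z ≠ 0 ∧ Ψ y z ≠ 0 := by
    intro x y h
    by_contra! h'
    apply h
    rw [hK, ← tsum_zero]
    congr 1; ext z
    by_cases hz : Ψ x z = 0
    · simp [hz]
    · simp [h' z hz]
  -- exchanging the two arguments on `A` is an involution of pairs of configurations
  let s : (ι → B) × (ι → B) → (ι → B) × (ι → B) := fun p =>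
    (fun i => if A i then p.2 i else p.1 i, fun i => if A i then p.1 i else p.2 i)
  have hs : Function.Involutive s := by
    rintro ⟨x, y⟩
    ext i
    · by_cases h : A i <;> simp [s, h]
    · by_cases h : A i <;> simp [s, h]
  have htr : ∀ x y, partialTranspose A K x y = K (s (x, y)).1 (s (x, y)).2 := fun x y => rfl
  have henn : ∑' p : (ι → B) × (ι → B), ‖partialTranspose A K p.1 p.2‖ₑ = ENNReal.ofReal t := by
    rw [← hsum]
    simp only [← hKe, htr]
    rw [← ENNReal.tsum_prod (f := fun x y => ‖K x y‖ₑ)]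
    exact hs.toPerm.tsum_eq fun p : (ι → B) × (ι → B) => ‖K p.1 p.2‖ₑ
  have hreal : HasSum (fun p : (ι → B) × (ι → B) => ‖partialTranspose A K p.1 p.2‖) t := by
    have hne : ∑' p : (ι → B) × (ι → B), ‖partialTranspose A K p.1 p.2‖ₑ ≠ ∞ := by
      rw [henn]; exact ENNReal.ofReal_ne_top
    have := ENNReal.hasSum_toReal hne
    simp only [toReal_enorm] at this
    convert this using 1
    have h3 := congrArg ENNReal.toReal henn
    rw [ENNReal.toReal_ofReal ht.le, ENNReal.tsum_toReal_eq (fun p => by simp)] at h3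
    simpa using h3.symm
  have hcol : ∀ x x' y, partialTranspose A K x y ≠ 0 → partialTranspose A K x' y ≠ 0 → x = x' := by
    intro x x' y h h'
    obtain ⟨z, h1, h2⟩ := hK0 _ _ h
    obtain ⟨z', h1', h2'⟩ := hK0 _ _ h'
    obtain ⟨e1, e2⟩ := hsparse _ _ _ _ z z' h1 h2 h1' h2'
      (fun i hi => by simp [hi]) (fun i hi => by simp [hi])
    ext i
    by_cases hi : A i
    · simpa [hi] using congrFun e2 i
    · simpa [hi] using congrFun e1 i
  have hrow : ∀ x y y', partialTranspose A K x y ≠ 0 → partialTranspose A K x y' ≠ 0 → y = y' := by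
    intro x y y' h h'
    obtain ⟨z, h1, h2⟩ := hK0 _ _ h
    obtain ⟨z', h1', h2'⟩ := hK0 _ _ h'
    -- Fixing the row rather than the column exchanges the roles of the two arguments of `K`.
    obtain ⟨e1, e2⟩ := hsparse _ _ _ _ z z' h2 h1 h2' h1'
      (fun i hi => by simp [hi]) (fun i hi => by simp [hi])
    ext i
    by_cases hi : A i
    · simpa [hi] using congrFun e2 i
    · simpa [hi] using congrFun e1 i
  obtain ⟨T, hT, hTt⟩ := exists_hasTraceNorm_of_sparse (partialTranspose A K) t hcol hrow hreal
  exact ⟨T, hT, t, ht, hTt, rfl⟩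

end Negativity

/-! ### Sums over product index sets -/

section PiSums

/-- Distributivity of products over sums in `ℝ≥0∞`. -/
lemma tsum_pi_fin_prod {α : Type} : ∀ {n : ℕ} (f : Fin n → α → ℝ≥0∞),
    ∑' x : Fin n → α, ∏ i, f i (x i) = ∏ i, ∑' a, f i a
  | 0, f => by simp
  | n + 1, f => by
    rw [← (Fin.consEquiv fun _ : Fin (n + 1) => α).tsum_eq, ENNReal.tsum_prod', Fin.prod_univ_succ,
      ← tsum_pi_fin_prod fun i => f i.succ, ← ENNReal.tsum_mul_right]
    congr 1; ext a
    rw [← ENNReal.tsum_mul_left]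
    congr 1; ext x
    simp [Fin.prod_univ_succ, Fin.consEquiv]

lemma tsum_pi_prod {ι α : Type} [Fintype ι] (f : ι → α → ℝ≥0∞) :
    ∑' x : ι → α, ∏ i, f i (x i) = ∏ i, ∑' a, f i a := by
  let e := Fintype.equivFin ι
  rw [← (e.arrowCongr (Equiv.refl α)).symm.tsum_eq, ← e.symm.prod_comp, ← tsum_pi_fin_prod]
  congr 1; ext x
  rw [← e.symm.prod_comp]
  simp [Equiv.arrowCongr]

lemma enorm_prod {ι : Type} [Fintype ι] (f : ι → ℂ) : ‖∏ i, f i‖ₑ = ∏ i, ‖f i‖ₑ := by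
  rw [← ofReal_norm, norm_prod, ENNReal.ofReal_prod_of_nonneg fun _ _ => norm_nonneg _]
  simp

end PiSums

/-! ### Configurations glued from edge states -/

/-- The local structure of torus states glued from interface states: a cylinder state is determined by
its two edge states, and each edge state belongs to one sector. -/
structure Gluing (M : ℕ) (E C A : Type) where
  left : C → E
  right : C → E
  cyl : ZMod (2 * M) → E → E → C
  left_cyl : ∀ i e e', left (cyl i e e') = e
  right_cyl : ∀ i e e', right (cyl i e e') = e'
  sec : E → A

namespace Gluing

variable {M : ℕ} {E C A : Type} (G : Gluing M E C A)

/-- The configuration of cylinders with edge state `N i` at interface `i`. -/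
def glue (N : ZMod (2 * M) → E) (i : ZMod (2 * M)) : C := G.cyl i (N i) (N (i + 1))

/-- The configurations in which the edges match. -/
def Matched (X : ZMod (2 * M) → C) : Prop := X = G.glue fun i => G.left (X i)

@[simp] lemma left_glue (N : ZMod (2 * M) → E) (i : ZMod (2 * M)) : G.left (G.glue N i) = N i :=
  G.left_cyl _ _ _

@[simp] lemma right_glue (N : ZMod (2 * M) → E) (i : ZMod (2 * M)) :
    G.right (G.glue N i) = N (i + 1) := G.right_cyl _ _ _

lemma glue_injective : Function.Injective G.glue := fun N N' h => by
  ext i; rw [← G.left_glue N, h, G.left_glue]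

variable {G}

lemma Matched.right_eq {X : ZMod (2 * M) → C} (h : G.Matched X) (i : ZMod (2 * M)) :
    G.right (X i) = G.left (X (i + 1)) := by
  have := congrArg G.right (congrFun h i)
  simpa using this

lemma Matched.eq_of_edges {X Y : ZMod (2 * M) → C} (hX : G.Matched X) (hY : G.Matched Y)
    {i : ZMod (2 * M)} (hl : G.left (X i) = G.left (Y i)) (hr : G.right (X i) = G.right (Y i)) :
    X i = Y i := by
  rw [congrFun hX i, congrFun hY i, glue, glue, ← hX.right_eq, ← hY.right_eq, hl, hr]

/-- A sum over configurations of a function supported on matched ones is a sum over edge states. -/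
lemma tsum_eq_tsum_glue {f : (ZMod (2 * M) → C) → ℝ≥0∞} (hf : ∀ X, f X ≠ 0 → G.Matched X) :
    ∑' X, f X = ∑' N, f (G.glue N) := by
  symm
  refine G.glue_injective.tsum_eq fun X hX => ?_
  exact ⟨_, (hf X hX).symm⟩

/-- Matched configurations are determined outside `S` on the second sublattice by their values on the
first one and the edges shared with `S`. -/
lemma Matched.eq_of_sublattice {O : ZMod (2 * M) → Prop} (hO : ∀ i, O (i + 1) ↔ ¬ O i)
    (S : Set (ZMod (2 * M))) {P Q P' Q' : ZMod (2 * M) → C}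
    (hP : G.Matched P) (hQ : G.Matched Q) (hP' : G.Matched P') (hQ' : G.Matched Q')
    (hS : ∀ i ∈ S, P i = Q i) (hS' : ∀ i ∈ S, P' i = Q' i)
    (hPO : ∀ i ∉ S, O i → P i = P' i) (hQO : ∀ i ∉ S, ¬ O i → Q i = Q' i) :
    ∀ i ∉ S, P i = P' i := by
  intro i hi
  by_cases hOi : O i
  · exact hPO i hi hOi
  have key : G.left (P i) = G.left (P' i) := by
    obtain ⟨j, rfl⟩ : ∃ j, i = j + 1 := ⟨i - 1, by ring⟩
    have hOj : O j := by by_contra h; exact hOi ((hO j).mpr h)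
    rw [← hP.right_eq, ← hP'.right_eq]
    -- The left edge of `i` is the right edge of its neighbour `j`, which lies in the sublattice
    -- `O`. If `j` is in `S`, the edge is transferred from `P` to `Q`, where it is the left edge of
    -- `Q i`, known by `hQO`. The right edge is treated in the same way below.
    by_cases hj : j ∈ S
    · rw [hS j hj, hS' j hj, hQ.right_eq, hQ'.right_eq, hQO _ hi hOi]
    · rw [hPO j hj hOj]
  refine hP.eq_of_edges hP' key ?_
  rw [hP.right_eq, hP'.right_eq]
  by_cases hj : i + 1 ∈ S
  · rw [hS _ hj, hS' _ hj, ← hQ.right_eq, ← hQ'.right_eq, hQO _ hi hOi]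
  · rw [hPO _ hj ((hO i).mpr hOi)]

end Gluing

/-- Since `2 * M` is even, reduction modulo it preserves parity, so odd and even cylinders alternate
also where the ring closes. -/
lemma isOdd_add_one {M : ℕ} [NeZero M] (i : ZMod (2 * M)) : IsOdd (i + 1) ↔ ¬ IsOdd i := by
  have h2 : Fact (1 < 2 * M) := ⟨by have := NeZero.pos M; omega⟩
  unfold IsOdd
  rw [ZMod.val_add, ZMod.val_one, Nat.odd_iff, Nat.odd_iff, Nat.mod_mul_right_mod]
  omega

/-! ### Sector states: norms and absolute sums -/

namespace Gluing

variable {M : ℕ} {E C A : Type} [DecidableEq A] (G : Gluing M E C A)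

/-- The amplitude of an edge state restricted to the sector `a`. -/
def amp (u : E → ℂ) (a : A) (e : E) : ℂ := if G.sec e = a then u e else 0

/-- `Ψ a` is, up to a positive factor, the sum of `∏ i, u (N i)` over the glued configurations with
all edges in sector `a`. -/
structure IsSectorFamily [NeZero M] (u : E → ℂ) (Ψ : A → (ZMod (2 * M) → C) → ℂ) : Prop where
  matched : ∀ a X, Ψ a X ≠ 0 → G.Matched X
  exists_factor : ∀ a, ∃ c : ℝ, 0 < c ∧ ∀ N, Ψ a (G.glue N) = c * ∏ i, G.amp u a (N i)

/-- The sums of the amplitudes and of their squares in each sector. -/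
structure HasSectorSums (u : E → ℂ) (α β : A → ℝ) : Prop where
  pos : ∀ a, 0 < α a
  sq_pos : ∀ a, 0 < β a
  hasSum : ∀ a, HasSum (fun e => ‖G.amp u a e‖) (α a)
  hasSum_sq : ∀ a, HasSum (fun e => ‖G.amp u a e‖ ^ 2) (β a)

variable {G} {u : E → ℂ} {Ψ : A → (ZMod (2 * M) → C) → ℂ} {α β : A → ℝ}

lemma HasSectorSums.tsum_enorm (h : G.HasSectorSums u α β) (a : A) :
    ∑' e, ‖G.amp u a e‖ₑ = ENNReal.ofReal (α a) := by
  rw [← (h.hasSum a).tsum_eq, ENNReal.ofReal_tsum_of_nonneg (fun _ => norm_nonneg _)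
    (h.hasSum a).summable]
  simp

lemma HasSectorSums.tsum_enorm_sq (h : G.HasSectorSums u α β) (a : A) :
    ∑' e, ‖G.amp u a e‖ₑ ^ 2 = ENNReal.ofReal (β a) := by
  rw [← (h.hasSum_sq a).tsum_eq, ENNReal.ofReal_tsum_of_nonneg (fun _ => by positivity)
    (h.hasSum_sq a).summable]
  simp [ENNReal.ofReal_pow]

variable [NeZero M]

/-- The squared norm is a product over `2 * M` independent interfaces, each contributing `β a`. The
factor `c`, which includes the normalization of the zero-mode state, cancels after normalization. -/
lemma sqrt_tsum_norm_sq (h : G.HasSectorSums u α β) {a : A} (Φ : (ZMod (2 * M) → C) → ℂ)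
    (hΦ : ∀ X, Φ X ≠ 0 → G.Matched X) {c : ℝ} (hc : 0 < c)
    (hglue : ∀ N, Φ (G.glue N) = c * ∏ i, G.amp u a (N i)) :
    Real.sqrt (∑' X, ‖Φ X‖ ^ 2) = c * β a ^ M := by
  have h1 : ∑' X, ‖Φ X‖ₑ ^ 2 = ENNReal.ofReal ((c * β a ^ M) ^ 2) := by
    rw [tsum_eq_tsum_glue (f := fun X => ‖Φ X‖ₑ ^ 2) fun X hX => hΦ X (by simpa using hX)]
    simp only [hglue, enorm_mul, enorm_prod, mul_pow, ← Finset.prod_pow]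
    rw [ENNReal.tsum_mul_left, tsum_pi_prod fun _ e => ‖G.amp u a e‖ₑ ^ 2]
    simp only [h.tsum_enorm_sq, Finset.prod_const, Finset.card_univ, ZMod.card]
    rw [ENNReal.ofReal_mul (by positivity), ENNReal.ofReal_pow hc.le,
      ENNReal.ofReal_pow (pow_nonneg (h.sq_pos a).le _), ENNReal.ofReal_pow (h.sq_pos a).le,
      ← ofReal_norm, Complex.norm_real, Real.norm_of_nonneg hc.le, ← pow_mul, mul_comm M 2]
  have h2 := congrArg ENNReal.toReal h1
  rw [ENNReal.tsum_toReal_eq (fun _ => by simp), ENNReal.toReal_ofReal (by positivity)] at h2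
  simp only [ENNReal.toReal_pow, toReal_enorm] at h2
  rw [h2, Real.sqrt_sq]
  have := h.sq_pos a
  positivity

/-- A configuration with an edge outside the sector has amplitude zero. -/
lemma prod_amp_eq_zero {N : ZMod (2 * M) → E} {i : ZMod (2 * M)} {a : A} (h : a ≠ G.sec (N i)) :
    ∏ i, G.amp u a (N i) = 0 :=
  Finset.prod_eq_zero (Finset.mem_univ i) (by rw [amp, if_neg h.symm])

section Superpose

variable [Fintype A]

lemma IsSectorFamily.superpose_glue (hΨ : G.IsSectorFamily u Ψ) (h : G.HasSectorSums u α β)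
    (ψ : A → ℂ) (N : ZMod (2 * M) → E) :
    superpose Ψ ψ (G.glue N) = ∑ a, ψ a / (β a : ℂ) ^ M * ∏ i, G.amp u a (N i) := by
  unfold superpose
  refine Finset.sum_congr rfl fun a _ => ?_
  obtain ⟨c, hc, hN⟩ := hΨ.exists_factor a
  rw [sqrt_tsum_norm_sq h (Ψ a) (hΨ.matched a) hc hN, hN]
  have := (h.sq_pos a).ne'
  have hc' : (c : ℂ) ≠ 0 := by exact_mod_cast hc.ne'
  push_cast
  field_simp

lemma IsSectorFamily.superpose_matched (hΨ : G.IsSectorFamily u Ψ) (ψ : A → ℂ)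
    (X : ZMod (2 * M) → C) (hX : superpose Ψ ψ X ≠ 0) : G.Matched X := by
  obtain ⟨a, -, ha⟩ := Finset.exists_ne_zero_of_sum_ne_zero hX
  refine hΨ.matched a X fun h0 => ha ?_
  simp [h0]

/-- The sector of one edge selects the only term of the superposition that can survive. The
interface `i` is left free so that it can later be chosen at a traced cylinder. -/
lemma IsSectorFamily.superpose_glue_eq (hΨ : G.IsSectorFamily u Ψ) (h : G.HasSectorSums u α β)
    (ψ : A → ℂ) (N : ZMod (2 * M) → E) (i : ZMod (2 * M)) :
    superpose Ψ ψ (G.glue N) =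
      ψ (G.sec (N i)) / (β (G.sec (N i)) : ℂ) ^ M * ∏ j, G.amp u (G.sec (N i)) (N j) := by
  rw [hΨ.superpose_glue h]
  refine Finset.sum_eq_single _ (fun a _ ha => ?_) (by simp)
  rw [prod_amp_eq_zero ha, mul_zero]

/-- The weight of the sector `a` in the normalized superposition. -/
def coeff (M : ℕ) (β : A → ℝ) (ψ : A → ℂ) (a : A) : ℝ≥0∞ := ENNReal.ofReal (‖ψ a‖ / β a ^ M)

/-- Different sectors have disjoint supports, so the absolute value may be taken term by term in the
sum over sectors. -/
lemma IsSectorFamily.enorm_superpose_glue (hΨ : G.IsSectorFamily u Ψ)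
    (h : G.HasSectorSums u α β) (ψ : A → ℂ) (N : ZMod (2 * M) → E) :
    ‖superpose Ψ ψ (G.glue N)‖ₑ = ∑ a, coeff M β ψ a * ∏ i, ‖G.amp u a (N i)‖ₑ := by
  rw [hΨ.superpose_glue_eq h ψ N 0, Finset.sum_eq_single (G.sec (N 0)), enorm_mul, enorm_prod, coeff,
    ← ofReal_norm, norm_div, norm_pow, Complex.norm_real, Real.norm_of_nonneg (h.sq_pos _).le]
  · intro a _ ha
    rw [← enorm_prod, prod_amp_eq_zero ha, enorm_zero, mul_zero]
  · simp

/-- The sum of the absolute values of the amplitudes. -/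
lemma IsSectorFamily.tsum_enorm_superpose (hΨ : G.IsSectorFamily u Ψ)
    (h : G.HasSectorSums u α β) (ψ : A → ℂ) :
    ∑' X, ‖superpose Ψ ψ X‖ₑ = ENNReal.ofReal (∑ a, ‖ψ a‖ * (α a ^ 2 / β a) ^ M) := by
  rw [tsum_eq_tsum_glue (G := G) fun X hX => hΨ.superpose_matched ψ X (by simpa using hX)]
  simp only [hΨ.enorm_superpose_glue h]
  rw [Summable.tsum_finsetSum fun _ _ => ENNReal.summable, ENNReal.ofReal_sum_of_nonneg]
  · refine Finset.sum_congr rfl fun a _ => ?_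
    rw [ENNReal.tsum_mul_left, tsum_pi_prod fun _ e => ‖G.amp u a e‖ₑ]
    simp only [h.tsum_enorm, Finset.prod_const, Finset.card_univ, ZMod.card, coeff]
    have hb := h.sq_pos a
    have ha := h.pos a
    rw [← ENNReal.ofReal_pow ha.le, ← ENNReal.ofReal_mul (by positivity)]
    congr 1
    rw [div_pow, ← pow_mul]
    ring
  · intro a _
    have hb := h.sq_pos a
    positivity

end Superpose

end Gluing

/-! ### Splitting configurations into traced and remaining cylinders -/

section Join

variable {ι B : Type} [DecidableEq ι] (S : Finset ι)

/-- The configuration equal to `z` on `S` and to `x` outside. -/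
def join (x : {i // i ∉ S} → B) (z : {i // i ∈ S} → B) (i : ι) : B :=
  if h : i ∈ S then z ⟨i, h⟩ else x ⟨i, h⟩

/-- Configurations are pairs of configurations outside and inside `S`. -/
def joinEquiv : ({i // i ∉ S} → B) × ({i // i ∈ S} → B) ≃ (ι → B) where
  toFun p := join S p.1 p.2
  invFun X := (fun i => X i, fun i => X i)
  left_inv p := by
    ext i
    · simp [join, i.2]
    · simp [join, i.2]
  right_inv X := by
    ext i
    by_cases h : i ∈ S <;> simp [join, h]

variable {S}

lemma join_of_mem {x : {i // i ∉ S} → B} {z : {i // i ∈ S} → B} {i : ι} (h : i ∈ S) :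
    join S x z i = z ⟨i, h⟩ := dif_pos h

lemma join_of_notMem {x : {i // i ∉ S} → B} {z : {i // i ∈ S} → B} {i : ι} (h : i ∉ S) :
    join S x z i = x ⟨i, h⟩ := dif_neg h

variable (S)

-- A choice of `x`, `y` outside `S` and a common `z` on `S` is the same as a pair of full
-- configurations that agree on `S`.
open scoped Classical in
lemma tsum_join (f : (ι → B) → ℝ≥0∞) :
    ∑' x, ∑' y, ∑' z, f (join S x z) * f (join S y z) =
      ∑' X, ∑' Y, if ∀ i ∈ S, X i = Y i then f X * f Y else 0 := by
  rw [← (joinEquiv S).tsum_eq, ENNReal.tsum_prod']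
  congr 1; ext x
  rw [ENNReal.tsum_comm]
  congr 1; ext z
  rw [← (joinEquiv S).tsum_eq, ENNReal.tsum_prod']
  congr 1; ext y
  rw [tsum_eq_single z]
  · rw [if_pos]
    · rfl
    · intro i hi
      simp [joinEquiv, join_of_mem hi]
  · intro w hw
    rw [if_neg]
    intro h
    apply hw
    ext ⟨i, hi⟩
    simpa [joinEquiv, join_of_mem hi] using (h i hi).symm

end Join

/-! ### Exact trace norms for the torus and for traced cylinders -/

namespace Gluing

variable {M : ℕ} {E C A : Type} {G : Gluing M E C A}

/-- Glued configurations agree on `S` iff the edge states agree at all interfaces touching `S`. -/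
lemma glue_eq_on_iff (S : Finset (ZMod (2 * M))) (N N' : ZMod (2 * M) → E) :
    (∀ i ∈ S, G.glue N i = G.glue N' i) ↔ ∀ i, ¬ (i - 1 ∉ S ∧ i ∉ S) → N i = N' i := by
  constructor
  · intro h i hi
    by_cases h1 : i ∈ S
    · simpa using congrArg G.left (h i h1)
    · have h2 : i - 1 ∈ S := by tauto
      simpa using congrArg G.right (h _ h2)
  · intro h i hi
    rw [glue, glue, h i (by tauto), h (i + 1) (by simp [hi])]

variable [NeZero M] [DecidableEq A] {u : E → ℂ} {Ψ : A → (ZMod (2 * M) → C) → ℂ} {α β : A → ℝ}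

-- Agreement on `S` is a condition on each interface separately, so the double sum is a product over
-- interfaces. An unconstrained interface gives `α a ^ 2`, a constrained one only its diagonal `β
-- a`.
open scoped Classical in
lemma HasSectorSums.tsum_pairs (h : G.HasSectorSums u α β) (S : Finset (ZMod (2 * M))) (a : A) :
    (∑' N, ∑' N', if ∀ i ∈ S, G.glue N i = G.glue N' i then
        (∏ i, ‖G.amp u a (N i)‖ₑ) * ∏ i, ‖G.amp u a (N' i)‖ₑ else 0) =
      ENNReal.ofReal ((α a ^ 2) ^ sharedInterfaces S * β a ^ (2 * M - sharedInterfaces S)) := by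
  let w : ZMod (2 * M) → E × E → ℝ≥0∞ := fun i p =>
    if ¬ (i - 1 ∉ S ∧ i ∉ S) → p.1 = p.2 then ‖G.amp u a p.1‖ₑ * ‖G.amp u a p.2‖ₑ else 0
  have hw : ∀ i, ∑' p, w i p =
      if i - 1 ∉ S ∧ i ∉ S then ENNReal.ofReal (α a ^ 2) else ENNReal.ofReal (β a) := by
    intro i
    rw [ENNReal.tsum_prod']
    split_ifs with hi
    · simp only [w, hi, not_true, false_imp_iff, if_true, not_false_eq_true, and_self]
      simp only [ENNReal.tsum_mul_left, ENNReal.tsum_mul_right, h.tsum_enorm]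
      rw [ENNReal.ofReal_pow (h.pos a).le, sq]
    · rw [← h.tsum_enorm_sq]
      congr 1; ext e
      rw [tsum_eq_single e]
      · simp [w, sq]
      · intro e' he'
        simp only [w]
        rw [if_neg]
        intro h'
        exact he' (h' hi).symm
  have hprod : ∀ P : ZMod (2 * M) → E × E, ∏ i, w i (P i) =
      if ∀ i ∈ S, G.glue (fun j => (P j).1) i = G.glue (fun j => (P j).2) i then
        (∏ i, ‖G.amp u a (P i).1‖ₑ) * ∏ i, ‖G.amp u a (P i).2‖ₑ else 0 := by
    intro P
    simp only [glue_eq_on_iff]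
    split_ifs with hP
    · rw [← Finset.prod_mul_distrib]
      exact Finset.prod_congr rfl fun i _ => if_pos (hP i)
    · push Not at hP
      obtain ⟨i, hi, hne⟩ := hP
      refine Finset.prod_eq_zero (Finset.mem_univ i) (if_neg fun h' => hne (h' ?_))
      tauto
  rw [← ENNReal.tsum_prod (f := fun N N' => if ∀ i ∈ S, G.glue N i = G.glue N' i then
        (∏ i, ‖G.amp u a (N i)‖ₑ) * ∏ i, ‖G.amp u a (N' i)‖ₑ else 0),
    ← (Equiv.arrowProdEquivProdArrow (ZMod (2 * M)) (fun _ => E) (fun _ => E)).tsum_eq]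
  have h1 := tsum_pi_prod w
  simp only [hprod, hw] at h1
  refine h1.trans ?_
  rw [Finset.prod_ite, Finset.prod_const, Finset.prod_const]
  have hcard := Finset.card_filter_add_card_filter_not (s := (Finset.univ : Finset (ZMod (2 * M))))
    (fun i : ZMod (2 * M) => i - 1 ∉ S ∧ i ∉ S)
  rw [Finset.card_univ, ZMod.card] at hcard
  have hα := h.pos a
  have hβ := h.sq_pos a
  rw [ENNReal.ofReal_mul (by positivity), ENNReal.ofReal_pow (sq_nonneg (α a)) (sharedInterfaces S),
    ENNReal.ofReal_pow hβ.le]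
  have hsh : sharedInterfaces S =
    (Finset.univ.filter fun i : ZMod (2 * M) => i - 1 ∉ S ∧ i ∉ S).card := by
    unfold sharedInterfaces; congr
  have hrest : 2 * M - sharedInterfaces S =
      (Finset.univ.filter fun i : ZMod (2 * M) => ¬ (i - 1 ∉ S ∧ i ∉ S)).card := by
    omega
  rw [hrest, hsh]

lemma sharedInterfaces_le (S : Finset (ZMod (2 * M))) : sharedInterfaces S ≤ 2 * M := by
  unfold sharedInterfaces
  refine (Finset.card_le_univ _).trans ?_
  rw [ZMod.card]

section Superpose

variable [Fintype A]

-- A cylinder in the nonempty `S` has the same edge in both configurations. This forces equal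
-- sectors, so the cross terms between sectors vanish and `‖ψ a‖ ^ 2` appears. The normalization `β
-- a ^ (2 * M)` removes the factors of the constrained interfaces and leaves one `β a` in the
-- denominator for each shared interface.
open scoped Classical in
lemma IsSectorFamily.tsum_pairs_superpose (hΨ : G.IsSectorFamily u Ψ)
    (h : G.HasSectorSums u α β) (ψ : A → ℂ) {S : Finset (ZMod (2 * M))} (hS : S.Nonempty) :
    (∑' X, ∑' Y, if ∀ i ∈ S, X i = Y i then ‖superpose Ψ ψ X‖ₑ * ‖superpose Ψ ψ Y‖ₑ else 0) =
      ENNReal.ofReal (∑ a, ‖ψ a‖ ^ 2 * (α a ^ 2 / β a) ^ sharedInterfaces S) := by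
  have hm : ∀ X, ‖superpose Ψ ψ X‖ₑ ≠ 0 → G.Matched X := fun X hX =>
    hΨ.superpose_matched ψ X (by simpa using hX)
  rw [tsum_eq_tsum_glue (G := G)]
  swap
  · intro X hX
    refine hm X fun h0 => hX ?_
    simp [h0]
  have h1 : ∀ N, (∑' Y, if ∀ i ∈ S, G.glue N i = Y i then
        ‖superpose Ψ ψ (G.glue N)‖ₑ * ‖superpose Ψ ψ Y‖ₑ else 0) =
      ∑' N', ∑ a, coeff M β ψ a ^ 2 * if ∀ i ∈ S, G.glue N i = G.glue N' i then
        (∏ i, ‖G.amp u a (N i)‖ₑ) * ∏ i, ‖G.amp u a (N' i)‖ₑ else 0 := by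
    intro N
    rw [tsum_eq_tsum_glue (G := G)]
    swap
    · intro X hX
      refine hm X fun h0 => hX ?_
      simp [h0]
    congr 1; ext N'
    split_ifs with hNN
    · obtain ⟨i, hi⟩ := hS
      have hsec : N i = N' i := by simpa using congrArg G.left (hNN i hi)
      rw [hΨ.enorm_superpose_glue h, hΨ.enorm_superpose_glue h,
        Finset.sum_eq_single (G.sec (N i)), Finset.sum_eq_single (G.sec (N i)),
        Finset.sum_eq_single (G.sec (N i))]
      · ring
      · intro a _ ha
        rw [← enorm_prod, prod_amp_eq_zero ha, enorm_zero, zero_mul, mul_zero]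
      · simp
      · intro a _ ha
        rw [← enorm_prod, prod_amp_eq_zero (i := i) (by rwa [← hsec]), enorm_zero, mul_zero]
      · simp
      · intro a _ ha
        rw [← enorm_prod, prod_amp_eq_zero ha, enorm_zero, mul_zero]
      · simp
    · simp
  simp only [h1]
  simp only [Summable.tsum_finsetSum fun _ _ => ENNReal.summable, ENNReal.tsum_mul_left,
    h.tsum_pairs]
  rw [ENNReal.ofReal_sum_of_nonneg]
  · refine Finset.sum_congr rfl fun a _ => ?_
    have hα := h.pos a
    have hβ := h.sq_pos a
    rw [coeff, ← ENNReal.ofReal_pow (by positivity), ← ENNReal.ofReal_mul (by positivity)]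
    congr 1
    have hpow : β a ^ (2 * M - sharedInterfaces S) * β a ^ sharedInterfaces S = (β a ^ M) ^ 2 := by
      rw [← pow_add, Nat.sub_add_cancel (sharedInterfaces_le S), ← pow_mul, mul_comm]
    rw [div_pow, div_pow (α a ^ 2), ← hpow]
    field_simp
  · intro a _
    have hβ := h.sq_pos a
    positivity

/-- The superposition of the normalized sector states is normalized. -/
theorem IsSectorFamily.hasSum_norm_sq (hΨ : G.IsSectorFamily u Ψ)
    (h : G.HasSectorSums u α β) {ψ : A → ℂ} (hψ : ∑ a, ‖ψ a‖ ^ 2 = 1) :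
    HasSum (fun X => ‖superpose Ψ ψ X‖ ^ 2) 1 := by
  classical
  -- With every cylinder in `S`, only diagonal pairs remain and no interface is shared, so the pair
  -- sum is the squared norm.
  have h1 := hΨ.tsum_pairs_superpose h ψ (S := Finset.univ) Finset.univ_nonempty
  have hR : sharedInterfaces (Finset.univ : Finset (ZMod (2 * M))) = 0 := by
    simp [sharedInterfaces]
  rw [hR] at h1
  simp only [pow_zero, mul_one, hψ, Finset.mem_univ, forall_const, ← funext_iff] at h1
  have h2 : ∑' X, ‖superpose Ψ ψ X‖ₑ ^ 2 = ENNReal.ofReal 1 := by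
    rw [← h1]
    congr 1; ext X
    rw [tsum_eq_single X]
    · simp [sq]
    · intro Y hY
      simp [hY.symm]
  have h3 := ENNReal.hasSum_toReal (h2 ▸ ENNReal.ofReal_ne_top)
  rw [← ENNReal.tsum_toReal_eq (fun _ => by simp), h2, ENNReal.toReal_ofReal zero_le_one] at h3
  simpa using h3

/-- The negativity of the torus state. -/
theorem IsSectorFamily.hasNegativity_torus (hΨ : G.IsSectorFamily u Ψ)
    (h : G.HasSectorSums u α β) {ψ : A → ℂ}
    (hpos : 0 < ∑ a, ‖ψ a‖ * (α a ^ 2 / β a) ^ M) :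
    HasNegativity IsOdd (pureDensity (superpose Ψ ψ))
      (Real.log ((∑ a, ‖ψ a‖ * (α a ^ 2 / β a) ^ M) ^ 2)) := by
  -- A pure state has a one-point index set in place of the traced configurations; sparsity is then
  -- the sublattice lemma with `S = ∅`.
  refine hasNegativity_of_sparse IsOdd (fun X (_ : Unit) => superpose Ψ ψ X) _
    (fun x y => by simp [pureDensity]) ?_ ?_ (by positivity) ?_
  · intro x y
    by_cases h0 : superpose Ψ ψ x * conj (superpose Ψ ψ y) = 0
    · refine ⟨1, by simp, fun _ => ?_⟩
      rw [h0]
      rcases mul_eq_zero.mp h0 with h | h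
      · simp [h]
      · simp [(map_eq_zero _).mp h]
    · refine ⟨_, ?_, fun _ => (div_mul_cancel₀ _ ?_).symm⟩
      · rw [norm_div, norm_mul, Complex.norm_conj, Complex.norm_real, norm_mul, norm_norm, norm_norm]
        apply div_self
        simpa using h0
      · simpa using h0
  · intro p q p' q' _ _ hp hq hp' hq' hO hO'
    have hp := hΨ.superpose_matched ψ _ hp
    have hq := hΨ.superpose_matched ψ _ hq
    have hp' := hΨ.superpose_matched ψ _ hp'
    have hq' := hΨ.superpose_matched ψ _ hq'
    constructor
    · ext1 i
      exact hp.eq_of_sublattice isOdd_add_one ∅ hq hp' hq' (by simp) (by simp)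
        (fun i _ => hO i) (fun i _ => hO' i) i (by simp)
    · ext1 i
      exact hq.eq_of_sublattice (O := fun i => ¬ IsOdd i)
        (fun i => by simp [isOdd_add_one i]) ∅ hp hq' hp' (by simp) (by simp)
        (fun i _ => hO' i) (fun i _ hi => hO i (not_not.mp hi)) i (by simp)
  · simp only [tsum_fintype, Finset.univ_unique, Finset.sum_singleton, ENNReal.tsum_mul_left,
      ENNReal.tsum_mul_right]
    rw [hΨ.tsum_enorm_superpose h, ENNReal.ofReal_pow hpos.le, sq]

lemma exists_phase (w : ℂ) : ∃ θ : ℂ, ‖θ‖ = 1 ∧ w = θ * (‖w‖ : ℂ) := by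
  by_cases h : w = 0
  · exact ⟨1, by simp, by simp [h]⟩
  · exact ⟨w / ‖w‖, by simp [h], (div_mul_cancel₀ _ (by simpa using h)).symm⟩

/-- The negativity after tracing over the cylinders in `S`. -/
theorem IsSectorFamily.hasNegativity_cylinder (hΨ : G.IsSectorFamily u Ψ)
    (h : G.HasSectorSums u α β) {ψ : A → ℂ} {S : Finset (ZMod (2 * M))} (hS : S.Nonempty)
    (hpos : 0 < ∑ a, ‖ψ a‖ ^ 2 * (α a ^ 2 / β a) ^ sharedInterfaces S) :
    HasNegativity (fun i : {i // i ∉ S} => IsOdd i.1)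
      (partialTrace S (pureDensity (superpose Ψ ψ)))
      (Real.log (∑ a, ‖ψ a‖ ^ 2 * (α a ^ 2 / β a) ^ sharedInterfaces S)) := by
  classical
  refine hasNegativity_of_sparse _ (fun x z => superpose Ψ ψ (join S x z)) _
    (fun x y => rfl) ?_ ?_ hpos ?_
  · intro x y
    choose θ hθ hθu using fun e => exists_phase (u e)
    -- Each interface is assigned to the cylinder of which it is the left edge. For cylinders in `S`
    -- the edge is the same in ket and bra and its phase cancels, so the total phase does not depend
    -- on `z`.
    refine ⟨∏ i : {i // i ∉ S}, θ (G.left (x i)) * conj (θ (G.left (y i))), ?_, fun z => ?_⟩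
    · simp [norm_prod, hθ]
    by_cases hx : superpose Ψ ψ (join S x z) = 0
    · simp [hx]
    by_cases hy : superpose Ψ ψ (join S y z) = 0
    · simp [hy]
    -- The traced cylinder `i₀` puts both configurations in one sector, so the coefficient `ψ a / β
    -- a ^ M` meets its own conjugate and contributes no phase.
    obtain ⟨i₀, hi₀⟩ := hS
    set N := fun i => G.left (join S x z i) with hN
    set N' := fun i => G.left (join S y z i) with hN'
    have ex : join S x z = G.glue N := hΨ.superpose_matched ψ _ hx
    have ey : join S y z = G.glue N' := hΨ.superpose_matched ψ _ hy
    have hsec : G.sec (N' i₀) = G.sec (N i₀) := by simp [hN, hN', join_of_mem hi₀]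
    have fx := hΨ.superpose_glue_eq h ψ N i₀
    have fy := hΨ.superpose_glue_eq h ψ N' i₀
    rw [← ex] at fx
    rw [← ey, hsec] at fy
    set a := G.sec (N i₀)
    have hamp : ∀ e, G.amp u a e = θ e * (‖G.amp u a e‖ : ℂ) := by
      intro e
      unfold amp
      split_ifs
      · exact hθu e
      · simp
    have hθprod : (∏ i, θ (N i)) * conj (∏ i, θ (N' i)) =
        ∏ i : {i // i ∉ S}, θ (G.left (x i)) * conj (θ (G.left (y i))) := by
      rw [map_prod, ← Finset.prod_mul_distrib, ← Fintype.prod_subtype_mul_prod_subtype (fun i => i ∈ S)]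
      rw [Finset.prod_eq_one, one_mul]
      swap
      · intro i _
        simp only [hN, hN', join_of_mem i.2]
        rw [Complex.mul_conj, Complex.normSq_eq_norm_sq, hθ]
        simp
      refine Finset.prod_congr rfl fun i _ => ?_
      simp only [hN, hN', join_of_notMem i.2]
    have hprod : ∀ N : ZMod (2 * M) → E, ∏ j, G.amp u a (N j) =
        (∏ j, θ (N j)) * (‖∏ j, G.amp u a (N j)‖ : ℂ) := by
      intro N
      rw [norm_prod, Complex.ofReal_prod, ← Finset.prod_mul_distrib]
      exact Finset.prod_congr rfl fun j _ => hamp _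
    rw [← hθprod, fx, fy, norm_mul, norm_mul, map_mul]
    conv_lhs => rw [hprod N, hprod N']
    rw [map_mul, Complex.conj_ofReal]
    have hn : ψ a / (β a : ℂ) ^ M * conj (ψ a / (β a : ℂ) ^ M) =
        ((‖ψ a / (β a : ℂ) ^ M‖ * ‖ψ a / (β a : ℂ) ^ M‖ : ℝ) : ℂ) := by
      rw [Complex.mul_conj, Complex.normSq_eq_norm_sq, sq]
    push_cast at hn ⊢
    linear_combination (∏ j, θ (N j)) * conj (∏ j, θ (N' j)) *
      (‖∏ j, G.amp u a (N j)‖ : ℂ) * (‖∏ j, G.amp u a (N' j)‖ : ℂ) * hn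
  · intro p q p' q' z z' hp hq hp' hq' hO hO'
    have hp := hΨ.superpose_matched ψ _ hp
    have hq := hΨ.superpose_matched ψ _ hq
    have hp' := hΨ.superpose_matched ψ _ hp'
    have hq' := hΨ.superpose_matched ψ _ hq'
    have hz : ∀ (p q : {i // i ∉ S} → C) z, ∀ i ∈ S, join S p z i = join S q z i :=
      fun p q z i hi => by rw [join_of_mem hi, join_of_mem hi]
    constructor
    · ext1 ⟨i, hi⟩
      have := hp.eq_of_sublattice isOdd_add_one S hq hp' hq' (hz _ _ _) (hz _ _ _)
        (fun i hi ho => by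
          have hi' : i ∉ S := hi
          rw [join_of_notMem hi', join_of_notMem hi']; exact hO ⟨i, hi⟩ ho)
        (fun i hi ho => by
          have hi' : i ∉ S := hi
          rw [join_of_notMem hi', join_of_notMem hi']; exact hO' ⟨i, hi⟩ ho) i hi
      rwa [join_of_notMem hi, join_of_notMem hi] at this
    · ext1 ⟨i, hi⟩
      have := hq.eq_of_sublattice (O := fun i => ¬ IsOdd i)
        (fun i => by simp [isOdd_add_one i]) S hp hq' hp' (hz _ _ _) (hz _ _ _)
        (fun i hi ho => by
          have hi' : i ∉ S := hi
          rw [join_of_notMem hi', join_of_notMem hi']; exact hO' ⟨i, hi⟩ ho)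
        (fun i hi ho => by
          have hi' : i ∉ S := hi
          rw [join_of_notMem hi', join_of_notMem hi']; exact hO ⟨i, hi⟩ (not_not.mp ho)) i hi
      rwa [join_of_notMem hi, join_of_notMem hi] at this
  · rw [tsum_join S fun X => ‖superpose Ψ ψ X‖ₑ]
    convert hΨ.tsum_pairs_superpose h ψ hS

end Superpose

end Gluing

/-! ### From partition-sum asymptotics to the negativity formulas -/

section Formulas

open Filter Topology

variable {A : Type} [Fintype A]

lemma exists_weight_pos {ψ : A → ℂ} (hψ : ∑ a, ‖ψ a‖ ^ 2 = 1) : ∃ a, 0 < ‖ψ a‖ := by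
  by_contra! h
  have : ∀ a, ‖ψ a‖ = 0 := fun a => le_antisymm (h a) (norm_nonneg _)
  simp [this] at hψ

lemma sum_weight_pos {w y : A → ℝ} (hw : ∀ a, 0 ≤ w a) (hw' : ∃ a, 0 < w a) (hy : ∀ a, 0 < y a)
    (n : ℕ) : 0 < ∑ a, w a * y a ^ n := by
  obtain ⟨a, ha⟩ := hw'
  exact Finset.sum_pos' (fun b _ => mul_nonneg (hw b) (pow_nonneg (hy b).le n))
    ⟨a, Finset.mem_univ a, mul_pos ha (pow_pos (hy a) n)⟩

/-- The asymptotics of `log ∑ w_a x_a^n` when `x_a ~ (d_a / D) e^{ηL/2}`. -/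
lemma tendsto_log_sum {w d : A → ℝ} (hw : ∀ a, 0 ≤ w a) (hw' : ∃ a, 0 < w a) (hd : ∀ a, 0 < d a)
    {D : ℝ} (hD : 0 < D) (n : ℕ) {η : ℝ} {x : ℝ → A → ℝ} (hx : ∀ L > 0, ∀ a, 0 < x L a)
    (hlim : ∀ a, Tendsto (fun L => x L a * Real.exp (-(η / 2 * L))) atTop (𝓝 (d a / D))) :
    Tendsto (fun L => Real.log (∑ a, w a * x L a ^ n) -
      (n / 2 * η * L - n * Real.log D + Real.log (∑ a, w a * d a ^ n))) atTop (𝓝 0) := by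
  have h1 : Tendsto (fun L => ∑ a, w a * (x L a * Real.exp (-(η / 2 * L))) ^ n) atTop
      (𝓝 (∑ a, w a * (d a / D) ^ n)) :=
    tendsto_finsetSum _ fun a _ => ((hlim a).pow n).const_mul (w a)
  have hpos := sum_weight_pos hw hw' hd n
  have e1 : ∑ a, w a * (d a / D) ^ n = (∑ a, w a * d a ^ n) / D ^ n := by
    rw [Finset.sum_div]
    exact Finset.sum_congr rfl fun a _ => by rw [div_pow, mul_div_assoc]
  rw [e1] at h1
  have h2 := (h1.log (by positivity)).sub_const (Real.log ((∑ a, w a * d a ^ n) / D ^ n))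
  rw [sub_self] at h2
  refine h2.congr' ?_
  filter_upwards [eventually_gt_atTop 0] with L hL
  have hpos' := sum_weight_pos hw hw' (hx L hL) n
  have e2 : ∑ a, w a * (x L a * Real.exp (-(η / 2 * L))) ^ n =
      (∑ a, w a * x L a ^ n) * Real.exp (n * -(η / 2 * L)) := by
    rw [Finset.sum_mul]
    exact Finset.sum_congr rfl fun a _ => by rw [mul_pow, ← Real.exp_nat_mul, mul_assoc]
  rw [e2, Real.log_mul hpos'.ne' (Real.exp_pos _).ne', Real.log_exp,
    Real.log_div hpos.ne' (by positivity), Real.log_pow]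
  ring

lemma totalDim_pos [Nonempty A] {d : A → ℝ} (hd : ∀ a, 0 < d a) : 0 < totalDim d :=
  Real.sqrt_pos.mpr (Finset.sum_pos (fun a _ => pow_pos (hd a) 2) Finset.univ_nonempty)

variable [DecidableEq A] {M : ℕ} [NeZero M] {E C : Type} {G : Gluing M E C A}
  {u : ℝ → E → ℂ} {Ψ : ℝ → A → (ZMod (2 * M) → C) → ℂ} {α β : ℝ → A → ℝ} {d : A → ℝ} {η : ℝ}

/-- The logarithmic asymptotics are applied with exponent `M` and weights `‖ψ a‖`; the trace norm is
a square, which doubles the result. -/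
theorem Gluing.torusFormula (hΨ : ∀ L > 0, G.IsSectorFamily (u L) (Ψ L))
    (h : ∀ L > 0, G.HasSectorSums (u L) (α L) (β L)) (hd : ∀ a, 0 < d a)
    (hlim : ∀ a, Tendsto (fun L => α L a ^ 2 / β L a * Real.exp (-(η / 2 * L))) atTop
      (𝓝 (d a / totalDim d)))
    {ψ : A → ℂ} (hψ : ∑ a, ‖ψ a‖ ^ 2 = 1) :
    TorusFormula M d ψ η (fun L => superpose (Ψ L) ψ) := by
  obtain ⟨a₀, ha₀⟩ := exists_weight_pos hψ
  have : Nonempty A := ⟨a₀⟩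
  have hD := totalDim_pos hd
  have hx : ∀ L > 0, ∀ a, 0 < α L a ^ 2 / β L a := fun L hL a =>
    div_pos (pow_pos ((h L hL).pos a) 2) ((h L hL).sq_pos a)
  refine ⟨_, fun L hL => (hΨ L hL).hasNegativity_torus (h L hL)
    (sum_weight_pos (fun a => norm_nonneg (ψ a)) ⟨a₀, ha₀⟩ (hx L hL) M), ?_⟩
  have := (tendsto_log_sum (fun a => norm_nonneg (ψ a)) ⟨a₀, ha₀⟩ hd hD M hx hlim).const_mul 2
  rw [mul_zero] at this
  refine this.congr fun L => ?_
  rw [Real.log_pow, Real.log_pow]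
  push_cast
  ring

/-- Here the exponent is the number of shared interfaces, the weights are `‖ψ a‖ ^ 2`, and there is
no square. -/
theorem Gluing.cylinderFormula (hΨ : ∀ L > 0, G.IsSectorFamily (u L) (Ψ L))
    (h : ∀ L > 0, G.HasSectorSums (u L) (α L) (β L)) (hd : ∀ a, 0 < d a)
    (hlim : ∀ a, Tendsto (fun L => α L a ^ 2 / β L a * Real.exp (-(η / 2 * L))) atTop
      (𝓝 (d a / totalDim d)))
    {ψ : A → ℂ} (hψ : ∑ a, ‖ψ a‖ ^ 2 = 1) {S : Finset (ZMod (2 * M))} (hS : S.Nonempty) :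
    CylinderFormula M d ψ η (fun L => superpose (Ψ L) ψ) S := by
  obtain ⟨a₀, ha₀⟩ := exists_weight_pos hψ
  have : Nonempty A := ⟨a₀⟩
  have hD := totalDim_pos hd
  have hx : ∀ L > 0, ∀ a, 0 < α L a ^ 2 / β L a := fun L hL a =>
    div_pos (pow_pos ((h L hL).pos a) 2) ((h L hL).sq_pos a)
  have hw : ∃ a, 0 < ‖ψ a‖ ^ 2 := ⟨a₀, by positivity⟩
  refine ⟨_, fun L hL => (hΨ L hL).hasNegativity_cylinder (h L hL) hS
    (sum_weight_pos (fun a => sq_nonneg ‖ψ a‖) hw (hx L hL) _), ?_⟩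
  refine (tendsto_log_sum (fun a => sq_nonneg ‖ψ a‖) hw hd hD (sharedInterfaces S) hx hlim).congr
    fun L => ?_
  rw [Real.log_pow]
  push_cast
  ring

end Formulas

/-! ### Bosonic, fermionic and theta sums and their modular asymptotics -/

section Products

open Filter Topology

/-- The sum over bosonic occupation numbers as a supremum of finite products. -/
lemma tsum_finsupp_prod_eq_iSup (X : ℕ → ℝ≥0∞) :
    ∑' n : ℕ →₀ ℕ, n.prod (fun j k => X j ^ k) = ⨆ s : Finset ℕ, ∏ j ∈ s, (1 - X j)⁻¹ := by
  classical
  let e : ∀ s : Finset ℕ, (s → ℕ) → (ℕ →₀ ℕ) := fun s g =>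
    (Finsupp.equivFunOnFinite.symm g).embDomain (Function.Embedding.subtype _)
  have he : ∀ s, Function.Injective (e s) := fun s =>
    (Finsupp.embDomain_injective _).comp (Equiv.injective _)
  have hsum : ∀ s : Finset ℕ, ∑' g : s → ℕ, (e s g).prod (fun j k => X j ^ k) = ∏ j ∈ s, (1 - X j)⁻¹ := by
    intro s
    rw [← Finset.prod_coe_sort]
    simp only [← ENNReal.tsum_geometric]
    rw [← tsum_pi_prod fun (i : s) k => X i ^ k]
    congr 1; ext g
    simp only [e]
    rw [Finsupp.prod_embDomain, Finsupp.prod_fintype _ _ (fun _ => pow_zero _)]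
    simp
  refine le_antisymm ?_ (iSup_le fun s => ?_)
  · rw [ENNReal.tsum_eq_iSup_sum]
    refine iSup_le fun T => ?_
    -- All occupation numbers in the finite set `T` live on the union of their supports, so the
    -- geometric series over these modes dominate the partial sum.
    refine le_iSup_of_le (T.biUnion fun n => n.support) ?_
    set s := T.biUnion fun n => n.support
    rw [← hsum s, ← Finset.sum_preimage (e s) T (he s).injOn]
    · exact ENNReal.sum_le_tsum _
    · intro n hn hn'
      exfalso
      apply hn'
      refine ⟨fun j => n j, ?_⟩
      ext j
      by_cases hj : j ∈ s
      · exact Finsupp.embDomain_apply_self (Function.Embedding.subtype (· ∈ s)) _ ⟨j, hj⟩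
      · have h0 : n j = 0 := by
          by_contra h
          exact hj (Finset.mem_biUnion.mpr ⟨n, hn, Finsupp.mem_support_iff.mpr h⟩)
        rw [h0]
        refine Finsupp.embDomain_of_notMem_range _ _ _ ?_
        simpa using hj
  · rw [← hsum s]
    exact ENNReal.tsum_comp_le_tsum_of_injective (he s) _

lemma tprod_one_sub_pos {x : ℕ → ℝ} (h1 : ∀ j, x j < 1) (hs : Summable fun j => ‖x j‖) :
    0 < ∏' j, (1 - x j) := by
  have hs' : Summable fun j => ‖-x j‖ := by simpa using hs
  have hne := tprod_one_add_ne_zero_of_summable (f := fun j => -x j)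
    (fun j => by have := h1 j; linarith) hs'
  have hm := multipliable_one_add_of_summable hs'
  simp only [← sub_eq_add_neg] at hne hm
  refine lt_of_le_of_ne ?_ hne.symm
  exact ge_of_tendsto' hm.hasProd fun s => Finset.prod_nonneg fun j _ => by
    have := h1 j; linarith

/-- The generating function of bosonic occupation numbers. -/
lemma hasSum_finsupp_prod {x : ℕ → ℝ} (h0 : ∀ j, 0 ≤ x j) (h1 : ∀ j, x j < 1) (hs : Summable x) :
    HasSum (fun n : ℕ →₀ ℕ => n.prod fun j k => x j ^ k) (∏' j, (1 - x j))⁻¹ := by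
  have hs1 : Summable fun j => ‖x j‖ := hs.norm
  have hpos := tprod_one_sub_pos h1 hs1
  have hs' : Summable fun j => ‖-x j‖ := by simpa using hs1
  have hm := multipliable_one_add_of_summable hs'
  simp only [← sub_eq_add_neg] at hm
  have hinv := hm.hasProd.inv₀ hpos.ne'
  have hfac : ∀ j, ENNReal.ofReal (1 - x j)⁻¹ = (1 - ENNReal.ofReal (x j))⁻¹ := by
    intro j
    rw [ENNReal.ofReal_inv_of_pos (by have := h1 j; linarith), ENNReal.ofReal_sub _ (h0 j),
      ENNReal.ofReal_one]
  have hfac0 : ∀ j, 0 ≤ (1 - x j)⁻¹ := fun j => inv_nonneg.mpr (by have := h1 j; linarith)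
  have h2 : ∑' n : ℕ →₀ ℕ, ENNReal.ofReal (n.prod fun j k => x j ^ k) =
      ENNReal.ofReal (∏' j, (1 - x j))⁻¹ := by
    have h3 : ∀ n : ℕ →₀ ℕ, ENNReal.ofReal (n.prod fun j k => x j ^ k) =
        n.prod fun j k => ENNReal.ofReal (x j) ^ k := by
      intro n
      rw [Finsupp.prod, ENNReal.ofReal_prod_of_nonneg fun j _ => pow_nonneg (h0 j) _]
      exact Finset.prod_congr rfl fun j _ => ENNReal.ofReal_pow (h0 j) _
    simp only [h3]
    rw [tsum_finsupp_prod_eq_iSup]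
    have hmono : Monotone fun s : Finset ℕ => ∏ j ∈ s, (1 - ENNReal.ofReal (x j))⁻¹ := by
      intro s t hst
      exact Finset.prod_le_prod_of_subset_of_one_le' hst fun j _ _ => by
        simp [ENNReal.one_le_inv]
    refine tendsto_nhds_unique (tendsto_atTop_iSup hmono) ?_
    have h4 := ENNReal.tendsto_ofReal hinv
    refine h4.congr fun s => ?_
    rw [ENNReal.ofReal_prod_of_nonneg fun j _ => hfac0 j]
    exact Finset.prod_congr rfl fun j _ => hfac j
  have hnn : ∀ n : ℕ →₀ ℕ, 0 ≤ n.prod fun j k => x j ^ k := fun n =>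
    Finset.prod_nonneg fun j _ => pow_nonneg (h0 j) _
  have h5 := ENNReal.hasSum_toReal (h2 ▸ ENNReal.ofReal_ne_top)
  rw [← ENNReal.tsum_toReal_eq (fun _ => by simp), h2,
    ENNReal.toReal_ofReal (inv_nonneg.mpr hpos.le)] at h5
  simpa [ENNReal.toReal_ofReal, hnn] using h5

/-- The generating function of fermionic occupation numbers. -/
lemma hasSum_finset_prod {x : ℕ → ℝ} (hs : Summable fun j => ‖x j‖) :
    HasSum (fun s : Finset ℕ => ∏ j ∈ s, x j) (∏' j, (1 + x j)) := by
  have h := summable_finsetProd_of_summable_norm hs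
  rw [tprod_one_add h]
  exact h.hasSum

/-- The nome `q = e^{-2πy}`. -/
def nome (y : ℝ) : ℝ := Real.exp (-(2 * Real.pi * y))

lemma nome_pos (y : ℝ) : 0 < nome y := Real.exp_pos _

lemma nome_lt_one {y : ℝ} (hy : 0 < y) : nome y < 1 := by
  rw [nome, Real.exp_lt_one_iff]
  have := Real.pi_pos
  nlinarith [mul_pos this hy]

lemma nome_two_mul (y : ℝ) : nome (2 * y) = nome y ^ 2 := by
  rw [nome, nome, ← Real.exp_nat_mul]; congr 1; push_cast; ring

lemma summable_nome {y : ℝ} (hy : 0 < y) : Summable fun j : ℕ => nome y ^ (j + 1) :=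
  (summable_nat_add_iff 1).mpr (summable_geometric_of_lt_one (nome_pos y).le (nome_lt_one hy))

/-- The Euler product `∏ (1 - q^j)`. -/
def eulerProd (y : ℝ) : ℝ := ∏' j : ℕ, (1 - nome y ^ (j + 1))

lemma nome_pow_lt_one {y : ℝ} (hy : 0 < y) (j : ℕ) : nome y ^ (j + 1) < 1 :=
  pow_lt_one₀ (nome_pos y).le (nome_lt_one hy) (Nat.succ_ne_zero j)

lemma eulerProd_pos {y : ℝ} (hy : 0 < y) : 0 < eulerProd y :=
  tprod_one_sub_pos (nome_pow_lt_one hy) (summable_nome hy).norm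

/-- On the imaginary axis the nome is real, and the factor `q ^ (1/24)` of the eta function becomes
`exp (-π y / 12)`. -/
lemma norm_eta {y : ℝ} (hy : 0 < y) :
    ‖ModularForm.eta (Complex.I * y)‖ = Real.exp (-(Real.pi * y / 12)) * eulerProd y := by
  have hq : Function.Periodic.qParam 1 (Complex.I * y) = (nome y : ℂ) := by
    rw [Function.Periodic.qParam, nome, Complex.ofReal_exp]
    congr 1
    push_cast
    linear_combination (2 * Real.pi * y : ℂ) * Complex.I_sq
  have h1 : ∏' n : ℕ, (1 - ModularForm.eta_q n (Complex.I * y)) = (eulerProd y : ℂ) := by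
    have hm : Multipliable fun j : ℕ => 1 - nome y ^ (j + 1) := by
      have := multipliable_one_add_of_summable (f := fun j : ℕ => -nome y ^ (j + 1))
        (by simpa using (summable_nome hy).norm)
      simpa [← sub_eq_add_neg] using this
    have h2 := hm.map_tprod (Complex.ofRealHom) Complex.continuous_ofReal
    rw [eulerProd]
    refine Eq.trans ?_ h2.symm
    congr 1; ext n
    simp [ModularForm.eta_q, hq]
  rw [ModularForm.eta, h1, norm_mul, Complex.norm_real, Real.norm_of_nonneg (eulerProd_pos hy).le,
    Function.Periodic.qParam, Complex.norm_exp]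
  congr 2
  have : (2 * Real.pi * Complex.I * (Complex.I * y) / (24 : ℝ) : ℂ) = ((-(Real.pi * y / 12) : ℝ) : ℂ) := by
    push_cast
    linear_combination (Real.pi * y / 12 : ℂ) * Complex.I_sq
  rw [this, Complex.ofReal_re]

/-- The modular transformation of the Euler product. -/
lemma eulerProd_inv {y : ℝ} (hy : 0 < y) :
    Real.sqrt y * Real.exp (Real.pi / (12 * y)) * eulerProd y =
      Real.exp (Real.pi * y / 12) * eulerProd y⁻¹ := by
  have h := ModularForm.eta_comp_eq_csqrt_I_inv
    (show Complex.I * y ∈ UpperHalfPlane.upperHalfPlaneSet by simpa using hy)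
  have e1 : -1 / (Complex.I * y) = Complex.I * ((y⁻¹ : ℝ) : ℂ) := by
    have : (y : ℂ) ≠ 0 := by exact_mod_cast hy.ne'
    push_cast
    field_simp
    simp
  simp only [Function.comp_apply, Pi.smul_apply, Pi.mul_apply, smul_eq_mul, e1] at h
  -- Taking norms discards the phases of the complex square roots and leaves a real identity.
  have h' := congrArg norm h
  rw [norm_mul, norm_mul, norm_inv, norm_eta hy, norm_eta (inv_pos.mpr hy)] at h'
  have hs : ∀ z : ℂ, z ≠ 0 → ‖Complex.sqrt z‖ = Real.sqrt ‖z‖ := by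
    intro z hz
    rw [Complex.sqrt, Complex.norm_cpow_of_ne_zero hz, Real.sqrt_eq_rpow]
    norm_num
  rw [hs _ Complex.I_ne_zero, hs _ (by simp [hy.ne'])] at h'
  simp only [Complex.norm_I, Real.sqrt_one, inv_one, one_mul, norm_mul, Complex.norm_real,
    Real.norm_of_nonneg hy.le] at h'
  have e2 : Real.pi / (12 * y) = Real.pi * y⁻¹ / 12 := by field_simp
  rw [e2]
  rw [Real.exp_neg, Real.exp_neg] at h'
  have p1 := Real.exp_pos (Real.pi * y⁻¹ / 12)
  have p2 := Real.exp_pos (Real.pi * y / 12)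
  generalize Real.exp (Real.pi * y⁻¹ / 12) = E₁ at *
  generalize Real.exp (Real.pi * y / 12) = E₂ at *
  generalize eulerProd y⁻¹ = p at *
  field_simp at h'
  linear_combination -h'

/-- The Euler product tends to `1` as `q → 0`. -/
lemma tendsto_eulerProd_atTop : Tendsto eulerProd atTop (𝓝 1) := by
  have hn : Tendsto nome atTop (𝓝 0) := by
    unfold nome
    refine Real.tendsto_exp_neg_atTop_nhds_zero.comp ?_
    exact Tendsto.const_mul_atTop (by positivity) tendsto_id
  have h := tendsto_tprod_one_add_of_dominated_convergence (𝓕 := atTop) (g := 0)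
      (f := fun (y : ℝ) (n : ℕ) ↦ -nome y ^ (n + 1)) (bound := fun n ↦ (1 / 2 : ℝ) ^ (n + 1))
      ((summable_nat_add_iff 1).mpr (summable_geometric_of_lt_one (by norm_num) (by norm_num)))
      (fun k => by simpa using (hn.pow (k + 1)).neg)
      (by
        filter_upwards [hn.eventually_lt_const (show (0 : ℝ) < 1 / 2 by norm_num)] with y hy k
        rw [norm_neg, norm_pow, Real.norm_of_nonneg (nome_pos y).le]
        exact pow_le_pow_left₀ (nome_pos y).le hy.le _)
  simp only [← sub_eq_add_neg, Pi.zero_apply, add_zero, tprod_one] at h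
  exact h

/-- The asymptotics of the Euler product as `q → 1`. -/
lemma tendsto_eulerProd_zero :
    Tendsto (fun y => Real.sqrt y * Real.exp (Real.pi / (12 * y)) * eulerProd y) (𝓝[>] 0) (𝓝 1) := by
  have h1 : Tendsto (fun y : ℝ => Real.exp (Real.pi * y / 12)) (𝓝[>] 0) (𝓝 1) := by
    have : Tendsto (fun y : ℝ => Real.exp (Real.pi * y / 12)) (𝓝 0) (𝓝 (Real.exp (Real.pi * 0 / 12))) :=
      (by fun_prop : Continuous fun y : ℝ => Real.exp (Real.pi * y / 12)).tendsto 0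
    simpa using this.mono_left nhdsWithin_le_nhds
  have h2 := h1.mul (tendsto_eulerProd_atTop.comp tendsto_inv_nhdsGT_zero)
  rw [mul_one] at h2
  refine h2.congr' ?_
  filter_upwards [self_mem_nhdsWithin] with y hy
  exact (eulerProd_inv hy).symm

/-- The bosonic partition function. -/
def bosonSum (y : ℝ) : ℝ := (eulerProd y)⁻¹

/-- The fermionic partition function for periodic fermions. -/
def fermionSum (y : ℝ) : ℝ := ∏' j : ℕ, (1 + nome y ^ (j + 1))

/-- The fermionic partition function for antiperiodic fermions. -/
def fermionSumHalf (y : ℝ) : ℝ := ∏' j : ℕ, (1 + nome (y / 2) ^ (2 * j + 1))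

lemma summable_nome_odd {y : ℝ} (hy : 0 < y) : Summable fun j : ℕ => nome (y / 2) ^ (2 * j + 1) :=
  (summable_nome (half_pos hy)).comp_injective (i := fun j => 2 * j) fun a b h => by
    simpa using h

lemma one_le_tprod_one_add {x : ℕ → ℝ} (h0 : ∀ j, 0 ≤ x j) (hs : Summable x) :
    1 ≤ ∏' j, (1 + x j) := by
  have hm := multipliable_one_add_of_summable (f := x) hs.norm
  refine ge_of_tendsto' hm.hasProd fun s => ?_
  exact Finset.prod_induction _ (fun p => 1 ≤ p) (fun a b => one_le_mul_of_one_le_of_one_le) le_rfl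
    fun j _ => by simpa using h0 j

lemma fermionSum_pos {y : ℝ} (hy : 0 < y) : 0 < fermionSum y :=
  zero_lt_one.trans_le (one_le_tprod_one_add (fun _ => pow_nonneg (nome_pos y).le _)
    (summable_nome hy))

lemma fermionSumHalf_pos {y : ℝ} (hy : 0 < y) : 0 < fermionSumHalf y :=
  zero_lt_one.trans_le (one_le_tprod_one_add (fun _ => pow_nonneg (nome_pos _).le _)
    (summable_nome_odd hy))

/-- Factorwise this is `(1 - q ^ j) * (1 + q ^ j) = 1 - q ^ (2 * j)`. It reduces periodic fermions
to Euler products. -/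
lemma eulerProd_mul_fermionSum {y : ℝ} (hy : 0 < y) :
    eulerProd y * fermionSum y = eulerProd (2 * y) := by
  have h1 := multipliable_one_add_of_summable (f := fun j : ℕ => -nome y ^ (j + 1))
    (by simpa using (summable_nome hy).norm)
  have h2 := multipliable_one_add_of_summable (f := fun j : ℕ => nome y ^ (j + 1))
    (summable_nome hy).norm
  simp only [← sub_eq_add_neg] at h1
  rw [eulerProd, fermionSum, ← h1.tprod_mul h2, eulerProd]
  congr 1; ext j
  rw [nome_two_mul]
  ring

/-- Half-integer and integer modes are the odd and even powers of the square root `nome (y / 2)` of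
the nome. -/
lemma fermionSumHalf_mul_fermionSum {y : ℝ} (hy : 0 < y) :
    fermionSumHalf y * fermionSum y = fermionSum (y / 2) := by
  have h1 := multipliable_one_add_of_summable (summable_nome_odd hy).norm
  have h2 := multipliable_one_add_of_summable (summable_nome hy).norm
  have hn : nome y = nome (y / 2) ^ 2 := by rw [← nome_two_mul]; ring_nf
  have e : ∀ k : ℕ, nome y ^ (k + 1) = nome (y / 2) ^ (2 * k + 1 + 1) := by
    intro k; rw [hn, ← pow_mul]; ring_nf
  simp only [e] at h2
  simp only [fermionSumHalf, fermionSum, e]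
  exact tprod_even_mul_odd (f := fun j => 1 + nome (y / 2) ^ (j + 1)) h1 h2

lemma tendsto_const_mul_nhdsGT_zero {c : ℝ} (hc : 0 < c) :
    Tendsto (fun y => c * y) (𝓝[>] 0) (𝓝[>] 0) := by
  refine tendsto_nhdsWithin_iff.mpr ⟨?_, ?_⟩
  · have : Tendsto (fun y : ℝ => c * y) (𝓝 0) (𝓝 (c * 0)) := tendsto_id.const_mul c
    rw [mul_zero] at this
    exact this.mono_left nhdsWithin_le_nhds
  · filter_upwards [self_mem_nhdsWithin] with y hy
    exact mul_pos hc hy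

lemma tendsto_bosonSum : Tendsto (fun y => bosonSum y / Real.sqrt y * Real.exp (-(Real.pi / (12 * y))))
    (𝓝[>] 0) (𝓝 1) := by
  have h := tendsto_eulerProd_zero.inv₀ one_ne_zero
  rw [inv_one] at h
  refine h.congr fun y => ?_
  rw [bosonSum, Real.exp_neg, mul_inv, mul_inv]
  ring

/-- In the quotient of Euler products at `2 * y` and `y`, the prefactors `y ^ (-1/2)` leave `1 /
√2`, and the exponents `π / (12 y)` and `π / (24 y)` leave their difference. This `√2` is the source
of the non-Abelian quantum dimension. -/
lemma tendsto_fermionSum : Tendsto (fun y => fermionSum y * Real.exp (-(Real.pi / (24 * y))))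
    (𝓝[>] 0) (𝓝 (Real.sqrt 2)⁻¹) := by
  have h := ((tendsto_eulerProd_zero.comp (tendsto_const_mul_nhdsGT_zero two_pos)).div
    tendsto_eulerProd_zero one_ne_zero).mul_const (Real.sqrt 2)⁻¹
  rw [div_one, one_mul] at h
  refine h.congr' ?_
  filter_upwards [self_mem_nhdsWithin] with y hy
  have hy : 0 < y := hy
  have e1 : Real.exp (Real.pi / (12 * y)) = Real.exp (Real.pi / (24 * y)) * Real.exp (Real.pi / (24 * y)) := by
    rw [← Real.exp_add]; congr 1; field_simp; norm_num
  have e2 : Real.pi / (12 * (2 * y)) = Real.pi / (24 * y) := by ring_nf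
  simp only [Pi.div_apply, Function.comp_apply]
  rw [← eulerProd_mul_fermionSum hy, e1, e2, Real.exp_neg, Real.sqrt_mul zero_le_two]
  have h1 := (eulerProd_pos hy).ne'
  have h2 := (Real.exp_pos (Real.pi / (24 * y))).ne'
  have h3 := (Real.sqrt_pos.mpr hy).ne'
  have h4 : Real.sqrt 2 ≠ 0 := by positivity
  generalize Real.exp (Real.pi / (24 * y)) = X at *
  field_simp

lemma tendsto_fermionSumHalf : Tendsto (fun y => fermionSumHalf y * Real.exp (-(Real.pi / (24 * y))))
    (𝓝[>] 0) (𝓝 1) := by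
  have h := (tendsto_fermionSum.comp (tendsto_const_mul_nhdsGT_zero (c := 1 / 2) (by norm_num))).div
    tendsto_fermionSum (by positivity)
  rw [div_self (by positivity)] at h
  refine h.congr' ?_
  filter_upwards [self_mem_nhdsWithin] with y hy
  have hy : 0 < y := hy
  have e1 : Real.pi / (24 * (1 / 2 * y)) = Real.pi / (24 * y) + Real.pi / (24 * y) := by
    field_simp; norm_num
  have e2 : 1 / 2 * y = y / 2 := by ring
  simp only [Pi.div_apply, Function.comp_apply]
  rw [e1, e2, ← fermionSumHalf_mul_fermionSum hy, neg_add, Real.exp_add]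
  have h1 := (fermionSum_pos hy).ne'
  have h2 := (Real.exp_pos (-(Real.pi / (24 * y)))).ne'
  generalize Real.exp (-(Real.pi / (24 * y))) = X at *
  field_simp

/-- The theta function of the charge modes. -/
def thetaSum (s c : ℝ) : ℝ := HurwitzZeta.evenKernel ((-s : ℝ) : UnitAddCircle) c

lemma hasSum_thetaSum (s : ℝ) {c : ℝ} (hc : 0 < c) :
    HasSum (fun n : ℤ => Real.exp (-(Real.pi * c) * (n - s) ^ 2)) (thetaSum s c) := by
  refine (HurwitzZeta.hasSum_int_evenKernel (-s) hc).congr_fun fun n => ?_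
  congr 1; ring

/-- By the functional equation the shift `s` enters only through the nonconstant Fourier modes of
the dual kernel, which decay exponentially. The limit is therefore the same for all charges. -/
lemma tendsto_thetaSum (s : ℝ) : Tendsto (fun c => thetaSum s c * Real.sqrt c) (𝓝[>] 0) (𝓝 1) := by
  obtain ⟨p, hp, hO⟩ := HurwitzZeta.isBigO_atTop_cosKernel_sub ((-s : ℝ) : UnitAddCircle)
  have h1 : Tendsto (fun x => Real.exp (-p * x)) atTop (𝓝 0) := by
    simp only [neg_mul]
    exact Real.tendsto_exp_neg_atTop_nhds_zero.comp (tendsto_id.const_mul_atTop hp)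
  have h2 := (hO.trans_tendsto h1).add_const 1
  simp only [sub_add_cancel, zero_add] at h2
  refine (h2.comp tendsto_inv_nhdsGT_zero).congr' ?_
  filter_upwards [self_mem_nhdsWithin] with c hc
  have hc : 0 < c := hc
  rw [thetaSum, HurwitzZeta.evenKernel_functional_equation, ← Real.sqrt_eq_rpow, Function.comp_apply,
    one_div c]
  have := (Real.sqrt_pos.mpr hc).ne'
  field_simp

end Products

/-- Only the moduli of the amplitudes matter, and both sums are positive because every sector
contains an edge state of positive weight. -/
lemma Gluing.hasSectorSums_of_weight {M : ℕ} {E C A : Type} [DecidableEq A] {G : Gluing M E C A}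
    {u : E → ℂ} {w : E → ℝ} {α β : A → ℝ} (hw : ∀ e, 0 < w e) (hu : ∀ e, ‖u e‖ = w e)
    (hne : ∀ a, ∃ e, G.sec e = a)
    (h1 : ∀ a, HasSum (fun e => if G.sec e = a then w e else 0) (α a))
    (h2 : ∀ a, HasSum (fun e => if G.sec e = a then w e ^ 2 else 0) (β a)) :
    G.HasSectorSums u α β := by
  have hpos : ∀ (f : E → ℝ) (_ : ∀ e, 0 < f e) (a : A) (t : ℝ),
      HasSum (fun e => if G.sec e = a then f e else 0) t → 0 < t := by
    intro f hf a t ht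
    obtain ⟨e, he⟩ := hne a
    have h := le_hasSum ht e fun e' _ => by
      split_ifs
      · exact (hf e').le
      · exact le_rfl
    rw [if_pos he] at h
    exact (hf e).trans_le h
  refine ⟨fun a => hpos _ hw a _ (h1 a), fun a => hpos _ (fun e => pow_pos (hw e) 2) a _ (h2 a),
    fun a => (h1 a).congr_fun fun e => ?_, fun a => (h2 a).congr_fun fun e => ?_⟩
  · unfold amp
    split_ifs
    · rw [hu]
    · simp
  · unfold amp
    split_ifs
    · rw [hu]
    · simp

/-! ### Edge partition sums -/

section EdgeSums

open Filter Topology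

/-- The Boltzmann factor of a bosonic configuration. -/
lemma exp_bosonEnergy (v : ℝ) {L : ℝ} (n : ℕ →₀ ℕ) :
    Real.exp (-(v / 2 * bosonEnergy L n)) =
      n.prod fun j k => (nome (v / (2 * L)) ^ (j + 1)) ^ k := by
  rw [bosonEnergy, Finsupp.sum, Finset.mul_sum, ← Finset.sum_neg_distrib, Real.exp_sum, Finsupp.prod]
  refine Finset.prod_congr rfl fun j _ => ?_
  rw [nome, ← pow_mul, ← Real.exp_nat_mul]
  congr 1
  push_cast
  ring

lemma hasSum_boson {v L : ℝ} (hv : 0 < v) (hL : 0 < L) :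
    HasSum (fun n : ℕ →₀ ℕ => Real.exp (-(v / 2 * bosonEnergy L n))) (bosonSum (v / (2 * L))) := by
  have hy : 0 < v / (2 * L) := by positivity
  simp only [exp_bosonEnergy]
  exact hasSum_finsupp_prod (fun j => pow_nonneg (nome_pos _).le _) (nome_pow_lt_one hy)
    (summable_nome hy)

/-- The sum of a product of real functions of independent variables. -/
lemma hasSum_mul_prod {β γ : Type} {f : β → ℝ} {g : γ → ℝ} {a b : ℝ}
    (hf : HasSum f a) (hg : HasSum g b) : HasSum (fun p : β × γ => f p.1 * g p.2) (a * b) :=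
  hf.mul hg (summable_mul_of_summable_norm hf.summable.norm hg.summable.norm)

/-- The ratio of partition sums at inverse temperatures `1` and `2`. -/
lemma tendsto_sq_div {α β : ℝ → ℝ} {c κ : ℝ} (hc : 0 < c)
    (hα : Tendsto (fun L => α L * Real.exp (-(2 * κ * L))) atTop (𝓝 c))
    (hβ : Tendsto (fun L => β L * Real.exp (-(κ * L))) atTop (𝓝 c)) :
    Tendsto (fun L => α L ^ 2 / β L * Real.exp (-(3 * κ * L))) atTop (𝓝 c) := by
  -- Both limits are the same constant, so the prefactor is `c ^ 2 / c = c`, and the rate is `2 * (2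
  -- * κ) - κ = 3 * κ`.
  have h := (hα.pow 2).div hβ hc.ne'
  have e : c ^ 2 / c = c := by field_simp
  rw [e] at h
  refine h.congr fun L => ?_
  simp only [Pi.div_apply]
  have e2 : Real.exp (-(3 * κ * L)) = Real.exp (-(2 * κ * L)) ^ 2 / Real.exp (-(κ * L)) := by
    rw [← Real.exp_nat_mul, ← Real.exp_sub]; congr 1; push_cast; ring
  rw [e2, mul_pow, div_mul_div_comm]

lemma tendsto_div_atTop_nhdsGT_zero {w : ℝ} (hw : 0 < w) :
    Tendsto (fun L => w / L) atTop (𝓝[>] 0) := by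
  refine tendsto_nhdsWithin_iff.mpr ⟨tendsto_const_nhds.div_atTop tendsto_id, ?_⟩
  filter_upwards [eventually_gt_atTop 0] with L hL
  exact div_pos hw hL

/-- The asymptotics of the partition sum of the charged boson. -/
lemma tendsto_theta_mul_boson {m : ℕ} (hm : 0 < m) (s : ℝ) :
    Tendsto (fun y => thetaSum s (m * y) * bosonSum y * Real.exp (-(Real.pi / (12 * y))))
      (𝓝[>] 0) (𝓝 (Real.sqrt m)⁻¹) := by
  have hm' : (0 : ℝ) < m := by exact_mod_cast hm
  -- The theta function behaves like `(m y) ^ (-1/2)` and the bosonic prefactor like `y ^ (1/2)`, so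
  -- only `m ^ (-1/2)` survives.
  have h := (((tendsto_thetaSum s).comp (tendsto_const_mul_nhdsGT_zero hm')).mul
    tendsto_bosonSum).mul_const (Real.sqrt m)⁻¹
  rw [one_mul, one_mul] at h
  refine h.congr' ?_
  filter_upwards [self_mem_nhdsWithin] with y hy
  have hy : 0 < y := hy
  have h1 := (Real.sqrt_pos.mpr hy).ne'
  have h2 := (Real.sqrt_pos.mpr hm').ne'
  rw [Function.comp_apply, Real.sqrt_mul hm'.le]
  field_simp

end EdgeSums

/-! ### The Laughlin state -/

section Laughlin

open Filter Topology

variable {m : ℕ}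

/-- The gluing data of the Laughlin state. -/
def laughlinGluing (M m : ℕ) : Gluing M (LaughlinEdge m) (LaughlinCyl m) (Fin m) where
  left := LaughlinCyl.left
  right := LaughlinCyl.right
  cyl _ e e' := ⟨e, e'⟩
  left_cyl _ _ _ := rfl
  right_cyl _ _ _ := rfl
  sec := LaughlinEdge.flux

lemma laughlin_isSectorFamily (M : ℕ) [NeZero M] (v L : ℝ) :
    (laughlinGluing M m).IsSectorFamily (fun e => (e.weight v L : ℂ)) (laughlinSector M v L) where
  matched a X hX := by
    ext1 i
    have h := Finset.prod_ne_zero_iff.mp hX (i + 1) (Finset.mem_univ _)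
    have h' : (X (i + 1 - 1)).right = (X (i + 1)).left := by
      by_contra hne
      exact h (if_neg fun hh => hne hh.1)
    rw [add_sub_cancel_right] at h'
    simp only [Gluing.glue, laughlinGluing]
    rw [← h']
  exists_factor a := by
    refine ⟨1, one_pos, fun N => ?_⟩
    rw [Complex.ofReal_one, one_mul]
    refine Finset.prod_congr rfl fun i _ => ?_
    simp only [laughlinInterface, Gluing.glue, laughlinGluing, Gluing.amp, sub_add_cancel, true_and]
    congr

/-- The partition sum of a Laughlin edge in sector `a`. -/
def laughlinSum (a : Fin m) (y : ℝ) : ℝ := thetaSum ((a : ℝ) / m) (m * y) * bosonSum y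

lemma laughlinEdge_weight_eq (v L : ℝ) (a : Fin m) (n : ℤ) (b : ℕ →₀ ℕ) :
    (LaughlinEdge.mk a n b).weight v L =
      Real.exp (-(Real.pi * (m * (v / (2 * L)))) * (n - (a : ℝ) / m) ^ 2) *
        Real.exp (-(v / 2 * bosonEnergy L b)) := by
  rw [LaughlinEdge.weight, ← Real.exp_add, LaughlinEdge.charge]
  congr 1
  ring

/-- Squaring doubles the velocity, so the sum of squares is the same partition sum at twice the
argument. -/
lemma laughlinEdge_weight_sq (v L : ℝ) (e : LaughlinEdge m) :
    e.weight v L ^ 2 = e.weight (2 * v) L := by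
  rw [LaughlinEdge.weight, LaughlinEdge.weight, ← Real.exp_nat_mul]
  congr 1
  push_cast
  ring

lemma hasSum_laughlin_weight (hm : 0 < m) {v L : ℝ} (hv : 0 < v) (hL : 0 < L) (a : Fin m) :
    HasSum (fun e : LaughlinEdge m => if e.flux = a then e.weight v L else 0)
      (laughlinSum a (v / (2 * L))) := by
  have hm' : (0 : ℝ) < m := by exact_mod_cast hm
  let f : ℤ × (ℕ →₀ ℕ) → LaughlinEdge m := fun p => ⟨a, p.1, p.2⟩
  have hf : Function.Injective f := by
    rintro ⟨n, b⟩ ⟨n', b'⟩ h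
    simpa [f] using h
  rw [← hf.hasSum_iff]
  · refine (hasSum_mul_prod (hasSum_thetaSum ((a : ℝ) / m) (c := m * (v / (2 * L))) (by positivity))
      (hasSum_boson hv hL)).congr_fun fun p => ?_
    simp only [f, Function.comp_apply, if_true]
    exact laughlinEdge_weight_eq v L a p.1 p.2
  · rintro ⟨a', n, b⟩ he
    refine if_neg fun h => he ⟨(n, b), ?_⟩
    simp only [f]
    rw [← h]

lemma laughlin_hasSectorSums (M : ℕ) (hm : 0 < m) {v L : ℝ} (hv : 0 < v) (hL : 0 < L) :
    (laughlinGluing M m).HasSectorSums (fun e => (e.weight v L : ℂ))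
      (fun a => laughlinSum a (v / (2 * L))) (fun a => laughlinSum a (v / L)) := by
  refine Gluing.hasSectorSums_of_weight (w := LaughlinEdge.weight v L) (fun e => Real.exp_pos _)
    (fun e => (Complex.norm_real _).trans (Real.norm_of_nonneg (Real.exp_pos _).le))
    (fun a => ⟨⟨a, 0, 0⟩, rfl⟩) (hasSum_laughlin_weight hm hv hL) fun a => ?_
  have h2 := hasSum_laughlin_weight hm (mul_pos two_pos hv) hL a
  have e : 2 * v / (2 * L) = v / L := by field_simp
  simp only [e, ← laughlinEdge_weight_sq] at h2
  exact h2

lemma totalDim_laughlin (m : ℕ) : totalDim (laughlinDim (m := m)) = Real.sqrt m := by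
  simp [totalDim, laughlinDim]

lemma tendsto_laughlinSum (hm : 0 < m) {w : ℝ} (hw : 0 < w) (a : Fin m) :
    Tendsto (fun L => laughlinSum a (w / L) * Real.exp (-(Real.pi / (12 * w) * L))) atTop
      (𝓝 (Real.sqrt m)⁻¹) := by
  refine ((tendsto_theta_mul_boson hm ((a : ℝ) / m)).comp
    (tendsto_div_atTop_nhdsGT_zero hw)).congr' ?_
  filter_upwards [eventually_gt_atTop 0] with L hL
  rw [Function.comp_apply, laughlinSum]
  congr 3
  field_simp

lemma tendsto_laughlin_ratio (hm : 0 < m) {v : ℝ} (hv : 0 < v) (a : Fin m) :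
    Tendsto (fun L => laughlinSum a (v / (2 * L)) ^ 2 / laughlinSum a (v / L) *
      Real.exp (-(Real.pi / (2 * v) / 2 * L))) atTop
      (𝓝 (laughlinDim a / totalDim (laughlinDim (m := m)))) := by
  have hm' : (0 : ℝ) < m := by exact_mod_cast hm
  rw [totalDim_laughlin, laughlinDim, one_div]
  have h1 := tendsto_laughlinSum hm (half_pos hv) a
  have h2 := tendsto_laughlinSum hm hv a
  have e1 : Real.pi / (12 * (v / 2)) = 2 * (Real.pi / (12 * v)) := by field_simp
  have e2 : Real.pi / (2 * v) / 2 = 3 * (Real.pi / (12 * v)) := by field_simp; norm_num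
  rw [e1] at h1
  simp only [div_div] at h1
  rw [e2]
  exact tendsto_sq_div (by positivity) h1 h2

theorem laughlin_formulas (hm : 0 < m) (M : ℕ) [NeZero M] {v : ℝ} (hv : 0 < v) {ψ : Fin m → ℂ}
    (hψ : ∑ a, ‖ψ a‖ ^ 2 = 1) :
    (∀ L > 0, HasSum (fun X => ‖laughlinState M v L ψ X‖ ^ 2) 1) ∧
      TorusFormula M laughlinDim ψ (Real.pi / (2 * v)) (fun L => laughlinState M v L ψ) ∧
      ∀ S : Finset (ZMod (2 * M)), S.Nonempty →
        CylinderFormula M laughlinDim ψ (Real.pi / (2 * v))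
          (fun L => laughlinState M v L ψ) S := by
  have hfam := fun L (_ : L > 0) => laughlin_isSectorFamily (m := m) M v L
  have hsums := fun L (hL : L > 0) => laughlin_hasSectorSums (m := m) M hm hv hL
  have hd : ∀ a : Fin m, 0 < laughlinDim a := fun _ => one_pos
  exact ⟨fun L hL => (hfam L hL).hasSum_norm_sq (hsums L hL) hψ,
    Gluing.torusFormula hfam hsums hd (tendsto_laughlin_ratio hm hv) hψ,
    fun S hS => Gluing.cylinderFormula hfam hsums hd (tendsto_laughlin_ratio hm hv) hψ hS⟩

end Laughlin

/-! ### Signed sums for the parity projection -/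

section FermionSums

open Filter Topology

/-- The product of the signed Boltzmann factors of antiperiodic fermions. -/
def fermionSumSigned (y : ℝ) : ℝ := ∏' j : ℕ, (1 - nome (y / 2) ^ (2 * j + 1))

lemma fermionSumSigned_nonneg {y : ℝ} (hy : 0 < y) : 0 ≤ fermionSumSigned y :=
  (tprod_one_sub_pos (fun j => nome_pow_lt_one (half_pos hy) (2 * j)) (summable_nome_odd hy).norm).le

/-- All factors lie in `[0, 1]`, so the product is at most its first factor. This crude bound
already tends to `0` with `y`. -/
lemma fermionSumSigned_le {y : ℝ} (hy : 0 < y) : fermionSumSigned y ≤ 1 - nome (y / 2) := by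
  have hm := multipliable_one_add_of_summable (f := fun j : ℕ => -nome (y / 2) ^ (2 * j + 1))
    (by simpa using (summable_nome_odd hy).norm)
  simp only [← sub_eq_add_neg] at hm
  refine le_of_tendsto hm.hasProd ?_
  filter_upwards [eventually_ge_atTop {0}] with s hs
  have h0 : 0 ∈ s := hs (by simp)
  have h1 : ∀ j : ℕ, 1 - nome (y / 2) ^ (2 * j + 1) ≤ 1 := fun j => by
    linarith [pow_pos (nome_pos (y / 2)) (2 * j + 1)]
  have h2 : ∀ j : ℕ, 0 ≤ 1 - nome (y / 2) ^ (2 * j + 1) := fun j => by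
    linarith [nome_pow_lt_one (half_pos hy) (2 * j)]
  rw [← Finset.mul_prod_erase s _ h0]
  refine (mul_le_of_le_one_right (h2 0) (Finset.prod_le_one (fun j _ => h2 j) fun j _ => h1 j)).trans ?_
  simp

lemma one_le_fermionSumHalf {y : ℝ} (hy : 0 < y) : 1 ≤ fermionSumHalf y :=
  one_le_tprod_one_add (fun _ => pow_nonneg (nome_pos _).le _) (summable_nome_odd hy)

/-- The alternating theta function of the charge modes. -/
def thetaSumSigned (s c : ℝ) : ℝ := ∑' n : ℤ, (n.negOnePow : ℝ) * Real.exp (-(Real.pi * c) * (n - s) ^ 2)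

lemma norm_negOnePow (n : ℤ) : ‖(n.negOnePow : ℝ)‖ = 1 := by
  rcases Int.units_eq_one_or n.negOnePow with h | h <;> simp [h]

lemma hasSum_thetaSumSigned (s : ℝ) {c : ℝ} (hc : 0 < c) :
    HasSum (fun n : ℤ => (n.negOnePow : ℝ) * Real.exp (-(Real.pi * c) * (n - s) ^ 2))
      (thetaSumSigned s c) := by
  refine Summable.hasSum (Summable.of_norm ?_)
  refine (hasSum_thetaSum s hc).summable.congr fun n => ?_
  rw [norm_mul, norm_negOnePow, one_mul, Real.norm_of_nonneg (Real.exp_pos _).le]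

lemma abs_thetaSumSigned_le (s : ℝ) {c : ℝ} (hc : 0 < c) : |thetaSumSigned s c| ≤ thetaSum s c := by
  rw [← Real.norm_eq_abs, ← (hasSum_thetaSumSigned s hc).tsum_eq]
  refine tsum_of_norm_bounded (hasSum_thetaSum s hc) fun n => ?_
  rw [norm_mul, norm_negOnePow, one_mul, Real.norm_of_nonneg (Real.exp_pos _).le]

lemma thetaSum_pos (s : ℝ) {c : ℝ} (hc : 0 < c) : 0 < thetaSum s c :=
  (Real.exp_pos _).trans_le (le_hasSum (hasSum_thetaSum s hc) 0 fun _ _ => (Real.exp_pos _).le)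

lemma bosonSum_pos {y : ℝ} (hy : 0 < y) : 0 < bosonSum y := inv_pos.mpr (eulerProd_pos hy)

end FermionSums

/-! ### The Moore–Read state as a glued state -/

section MooreRead

open Filter Topology

variable {m : ℕ}

/-- The sector of an edge state. -/
def MREdge.sector (e : MREdge m) : MRSector m :=
  (if e.twisted then .xi else if Even e.parity then .one else .chi, e.r)

/-- The parity constraint of a twisted cylinder, without the zero mode. -/
def mrRestParity {M : ℕ} (i : ZMod (2 * M)) (e e' : MREdge m) : ℤ :=
  -e.n + e'.n + (e.fermion.card + e'.fermion.card) + if i = 0 then 1 else 0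

/-- The gluing data of the Moore-Read state. -/
def mrGluing (M m : ℕ) : Gluing M (MREdge m) (MRCyl m) (MRSector m) where
  left := MRCyl.left
  right := MRCyl.right
  -- The zero-mode occupation is the one solving the parity constraint of the cylinder; the extra
  -- unit at `i = 0` makes this depend on `i`.
  cyl i e e' := ⟨e, e', e.twisted && decide (Odd (mrRestParity i e e'))⟩
  left_cyl _ _ _ := rfl
  right_cyl _ _ _ := rfl
  sec := MREdge.sector

/-- The amplitude of an edge state. -/
def mrAmp (v v' L : ℝ) (e : MREdge m) : ℂ := Complex.I ^ e.fermion.card * (e.weight v v' L : ℂ)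

lemma sector_eq_xi_iff (e : MREdge m) (r : Fin m) :
    e.sector = (.xi, r) ↔ e.twisted = true ∧ e.r = r := by
  unfold MREdge.sector
  cases h : e.twisted
  · by_cases h2 : Even e.parity <;> simp [h2]
  · simp

lemma sector_eq_one_iff (e : MREdge m) (r : Fin m) :
    e.sector = (.one, r) ↔ (e.twisted = false ∧ e.r = r) ∧ Even e.parity := by
  unfold MREdge.sector
  cases h : e.twisted
  · by_cases h2 : Even e.parity <;> simp [h2]
  · simp

lemma sector_eq_chi_iff (e : MREdge m) (r : Fin m) :
    e.sector = (.chi, r) ↔ (e.twisted = false ∧ e.r = r) ∧ ¬ Even e.parity := by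
  unfold MREdge.sector
  cases h : e.twisted
  · by_cases h2 : Even e.parity <;> simp [h2]
  · simp

lemma mrInterface_ne_zero {v v' L : ℝ} {t : Bool} {r : Fin m} {R K : MREdge m}
    (h : mrInterface v v' L t r R K ≠ 0) : R = K ∧ K.twisted = t ∧ K.r = r := by
  by_contra hne
  exact h (if_neg hne)

lemma cylinderParity_eq {M : ℕ} (i : ZMod (2 * M)) (c : MRCyl m) :
    cylinderParity i c = mrRestParity i c.left c.right + c.gamma.toNat := by
  unfold cylinderParity mrRestParity
  ring

/-- The parity constraint has exactly one solution for the zero mode, so a twisted cylinder carries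
no information beyond its two edges. -/
lemma even_add_toNat_iff (p : ℤ) (γ : Bool) : Even (p + (γ.toNat : ℤ)) ↔ γ = decide (Odd p) := by
  cases γ
  · simp
  · simp

/-- The projector acts on each interface separately and, with the boundary conditions, is exactly
the indicator of the sector of the edge. The parity offset `p` treats both untwisted types at once.
-/
lemma mr_exists_factor_untwisted (M : ℕ) [NeZero M] (v v' L : ℝ) (p : ℤ) (r : Fin m)
    (l : IsingLabel)
    (hl : ∀ e : MREdge m, e.sector = (l, r) ↔ (e.twisted = false ∧ e.r = r) ∧ Even (e.parity + p))
    (N : ZMod (2 * M) → MREdge m) :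
    mrUntwisted M v v' L p r ((mrGluing M m).glue N) =
      ∏ i, (mrGluing M m).amp (mrAmp v v' L) (l, r) (N i) := by
  refine Finset.prod_congr rfl fun i _ => ?_
  have hsec : (mrGluing M m).sec (N i) = (N i).sector := rfl
  rw [Gluing.amp, hsec]
  simp only [Gluing.glue, mrGluing, sub_add_cancel, mrInterface, true_and]
  by_cases h1 : (N i).twisted = false ∧ (N i).r = r
  · rw [if_pos h1]
    by_cases h2 : Even ((N i).parity + p)
    · rw [parityProj, if_pos h2, if_pos ((hl _).mpr ⟨h1, h2⟩), mrAmp]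
      simp [h1.1]
    · rw [parityProj, if_neg h2, if_neg fun h => h2 ((hl _).mp h).2]
      simp
  · rw [if_neg h1, if_neg fun h => h1 ((hl _).mp h).1]
    simp

lemma mr_matched_untwisted (M : ℕ) [NeZero M] (v v' L : ℝ) (p : ℤ) (r : Fin m)
    (X : ZMod (2 * M) → MRCyl m) (hX : mrUntwisted M v v' L p r X ≠ 0) :
    (mrGluing M m).Matched X := by
  ext1 i
  have h := fun i => Finset.prod_ne_zero_iff.mp hX i (Finset.mem_univ _)
  have h1 := mrInterface_ne_zero (left_ne_zero_of_mul (left_ne_zero_of_mul (h (i + 1))))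
  have h2 := mrInterface_ne_zero (left_ne_zero_of_mul (left_ne_zero_of_mul (h i)))
  have h3 : (X i).gamma = false := by
    by_contra hne
    have h4 := right_ne_zero_of_mul (h i)
    simp [hne] at h4
  have h1' := h1.1
  rw [add_sub_cancel_right] at h1'
  simp only [Gluing.glue, mrGluing]
  rw [← h1', h2.2.1, Bool.false_and, ← h3]

lemma mr_matched_twisted (M : ℕ) [NeZero M] (v v' L : ℝ) (r : Fin m)
    (X : ZMod (2 * M) → MRCyl m) (hX : mrTwisted M v v' L r X ≠ 0) :
    (mrGluing M m).Matched X := by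
  ext1 i
  have h := fun i => mrInterface_ne_zero (Finset.prod_ne_zero_iff.mp
    (left_ne_zero_of_mul (left_ne_zero_of_mul hX)) i (Finset.mem_univ _))
  have hp := Finset.prod_ne_zero_iff.mp (right_ne_zero_of_mul hX) i (Finset.mem_univ _)
  have hp' : Even (cylinderParity i (X i)) := by
    by_contra hne
    exact hp (if_neg hne)
  rw [cylinderParity_eq, even_add_toNat_iff] at hp'
  have h1 := (h (i + 1)).1
  rw [add_sub_cancel_right] at h1
  simp only [Gluing.glue, mrGluing]
  rw [← h1, (h i).2.1, Bool.true_and, ← hp']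

/-- The zero mode occupation numbers determined by the projections have odd sum. -/
lemma odd_sum_gamma (M : ℕ) [NeZero M] (X : ZMod (2 * M) → MRCyl m)
    (hr : ∀ i, (X (i - 1)).right = (X i).left) (h : ∀ i, Even (cylinderParity i (X i))) :
    Odd (∑ i, (X i).gamma.toNat) := by
  have hr' : ∀ i, (X i).right = (X (i + 1)).left := fun i => by
    rw [← hr, add_sub_cancel_right]
  have hsum : Even (∑ i, cylinderParity i (X i)) := Finset.even_sum _ fun i _ => h i
  have hshift : ∀ f : ZMod (2 * M) → ℤ, ∑ i, f (i + 1) = ∑ i, f i := fun f =>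
    Equiv.sum_comp (Equiv.addRight (1 : ZMod (2 * M))) f
  -- Around the ring the charges cancel, every fermion number is counted twice, and the extra unit
  -- appears once.
  have e : ∑ i, cylinderParity i (X i) =
      2 * ∑ i, ((X i).left.fermion.card : ℤ) + ((∑ i, (X i).gamma.toNat : ℕ) : ℤ) + 1 := by
    simp only [cylinderParity, hr', Finset.sum_add_distrib, Finset.sum_neg_distrib]
    rw [hshift fun i => (X i).left.n, hshift fun i => ((X i).left.fermion.card : ℤ)]
    rw [Finset.sum_ite_eq' Finset.univ (0 : ZMod (2 * M)) fun _ => (1 : ℤ)]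
    push_cast
    simp
    ring
  rw [e] at hsum
  rw [← Int.odd_coe_nat]
  rw [Int.even_add_one, Int.not_even_iff_odd] at hsum
  obtain ⟨k, hk⟩ := hsum
  exact ⟨k - ∑ i, ((X i).left.fermion.card : ℤ), by linarith⟩

/-- On glued twisted edges all cylinder projectors equal `1`, and the zero modes they fix
automatically have odd sum. The zero-mode amplitude is then one positive constant. -/
lemma mr_exists_factor_twisted (M : ℕ) [NeZero M] (v v' L : ℝ) (r : Fin m)
    (N : ZMod (2 * M) → MREdge m) :
    mrTwisted M v v' L r ((mrGluing M m).glue N) =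
      ((1 / Real.sqrt (2 ^ (2 * M - 1)) : ℝ) : ℂ) *
        ∏ i, (mrGluing M m).amp (mrAmp v v' L) (.xi, r) (N i) := by
  have hprod : ∏ i, mrInterface v v' L true r (((mrGluing M m).glue N) (i - 1)).right
      (((mrGluing M m).glue N) i).left =
      ∏ i, (mrGluing M m).amp (mrAmp v v' L) (.xi, r) (N i) := by
    refine Finset.prod_congr rfl fun i _ => ?_
    have hsec : (mrGluing M m).sec (N i) = (N i).sector := rfl
    rw [Gluing.amp, hsec]
    simp only [Gluing.glue, mrGluing, sub_add_cancel, mrInterface, true_and]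
    by_cases h1 : (N i).twisted = true ∧ (N i).r = r
    · rw [if_pos h1, if_pos ((sector_eq_xi_iff _ _).mpr h1), mrAmp]
    · rw [if_neg h1, if_neg fun h => h1 ((sector_eq_xi_iff _ _).mp h)]
  unfold mrTwisted
  rw [hprod]
  by_cases h0 : ∏ i, (mrGluing M m).amp (mrAmp v v' L) (.xi, r) (N i) = 0
  · rw [h0]; simp
  have htw : ∀ i, (N i).twisted = true := by
    intro i
    have h := Finset.prod_ne_zero_iff.mp h0 i (Finset.mem_univ _)
    by_contra hne
    refine h (if_neg fun hs => hne ?_)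
    exact ((sector_eq_xi_iff (N i) r).mp hs).1
  have hpar : ∀ i, Even (cylinderParity i ((mrGluing M m).glue N i)) := by
    intro i
    rw [cylinderParity_eq, even_add_toNat_iff]
    simp [Gluing.glue, mrGluing, htw]
  have hodd := odd_sum_gamma M ((mrGluing M m).glue N)
    (fun i => by simp [Gluing.glue, mrGluing]) hpar
  have hp1 : ∏ i, parityProj (cylinderParity i ((mrGluing M m).glue N i)) = 1 :=
    Finset.prod_eq_one fun i _ => if_pos (hpar i)
  rw [hp1, majoranaZero, if_pos hodd]
  ring

lemma mr_isSectorFamily (M : ℕ) [NeZero M] (v v' L : ℝ) :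
    (mrGluing M m).IsSectorFamily (mrAmp v v' L) (mrSector M v v' L) where
  matched := by
    rintro ⟨l, r⟩ X hX
    cases l
    · exact mr_matched_untwisted M v v' L _ r X hX
    · exact mr_matched_untwisted M v v' L _ r X hX
    · exact mr_matched_twisted M v v' L r X hX
  exists_factor := by
    rintro ⟨l, r⟩
    cases l
    · refine ⟨1, one_pos, fun N => ?_⟩
      rw [Complex.ofReal_one, one_mul]
      exact mr_exists_factor_untwisted M v v' L 0 r .one
        (fun e => by rw [sector_eq_one_iff, add_zero]) N
    · refine ⟨1, one_pos, fun N => ?_⟩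
      rw [Complex.ofReal_one, one_mul]
      exact mr_exists_factor_untwisted M v v' L 1 r .chi
        (fun e => by rw [sector_eq_chi_iff, Int.even_add_one]) N
    · exact ⟨_, by positivity, mr_exists_factor_twisted M v v' L r⟩

end MooreRead

/-! ### Moore–Read partition sums and their asymptotics -/

section MooreReadSums

open Filter Topology

variable {m : ℕ}

lemma hasSum_fermion {v L : ℝ} (hv : 0 < v) (hL : 0 < L) :
    HasSum (fun s : Finset ℕ => Real.exp (-(v / 2 * ∑ j ∈ s, 2 * Real.pi * (j + 1) / L)))
      (fermionSum (v / (2 * L))) := by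
  have hy : 0 < v / (2 * L) := by positivity
  refine (hasSum_finset_prod (summable_nome hy).norm).congr_fun fun s => ?_
  rw [Finset.mul_sum, ← Finset.sum_neg_distrib, Real.exp_sum]
  refine Finset.prod_congr rfl fun j _ => ?_
  rw [nome, ← Real.exp_nat_mul]
  congr 1
  push_cast
  field_simp

lemma exp_fermionEnergy_half (v L : ℝ) (s : Finset ℕ) :
    Real.exp (-(v / 2 * ∑ j ∈ s, 2 * Real.pi * (j + 1 / 2) / L)) =
      ∏ j ∈ s, nome (v / (2 * L) / 2) ^ (2 * j + 1) := by
  rw [Finset.mul_sum, ← Finset.sum_neg_distrib, Real.exp_sum]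
  refine Finset.prod_congr rfl fun j _ => ?_
  rw [nome, ← Real.exp_nat_mul]
  congr 1
  push_cast
  ring

lemma hasSum_fermionHalf {v L : ℝ} (hv : 0 < v) (hL : 0 < L) :
    HasSum (fun s : Finset ℕ => Real.exp (-(v / 2 * ∑ j ∈ s, 2 * Real.pi * (j + 1 / 2) / L)))
      (fermionSumHalf (v / (2 * L))) := by
  have hy : 0 < v / (2 * L) := by positivity
  simp only [exp_fermionEnergy_half]
  exact hasSum_finset_prod (summable_nome_odd hy).norm

lemma hasSum_fermionSigned {v L : ℝ} (hv : 0 < v) (hL : 0 < L) :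
    HasSum (fun s : Finset ℕ => (-1 : ℝ) ^ s.card *
      Real.exp (-(v / 2 * ∑ j ∈ s, 2 * Real.pi * (j + 1 / 2) / L)))
      (fermionSumSigned (v / (2 * L))) := by
  have hy : 0 < v / (2 * L) := by positivity
  have h := hasSum_finset_prod (x := fun j : ℕ => -nome (v / (2 * L) / 2) ^ (2 * j + 1))
    (by simpa using (summable_nome_odd hy).norm)
  simp only [← sub_eq_add_neg] at h
  refine h.congr_fun fun s => ?_
  rw [exp_fermionEnergy_half, Finset.prod_neg]

/-- The partition sum of a twisted edge. -/
def mrSumTwisted (r : Fin m) (y y' : ℝ) : ℝ :=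
  thetaSum (((r : ℝ) + 1 / 2) / m) (m * y) * bosonSum y * fermionSum y'

/-- The unprojected partition sum of an untwisted edge. -/
def mrSumFull (r : Fin m) (y y' : ℝ) : ℝ :=
  thetaSum ((r : ℝ) / m) (m * y) * bosonSum y * fermionSumHalf y'

/-- The partition sum of an untwisted edge with the sign of the combined parity. -/
def mrSumSigned (r : Fin m) (y y' : ℝ) : ℝ :=
  thetaSumSigned ((r : ℝ) / m) (m * y) * bosonSum y * fermionSumSigned y'

/-- The partition sum of an edge in sector `a`. -/
def mrSum (a : MRSector m) (y y' : ℝ) : ℝ :=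
  match a.1 with
  | .one => (mrSumFull a.2 y y' + mrSumSigned a.2 y y') / 2
  | .chi => (mrSumFull a.2 y y' - mrSumSigned a.2 y y') / 2
  | .xi => mrSumTwisted a.2 y y'

lemma mrEdge_weight_twisted (v v' L : ℝ) (r : Fin m) (n : ℤ) (b : ℕ →₀ ℕ) (s : Finset ℕ) :
    (MREdge.mk true r n b s).weight v v' L =
      Real.exp (-(Real.pi * (m * (v / (2 * L)))) * (n - ((r : ℝ) + 1 / 2) / m) ^ 2) *
        Real.exp (-(v / 2 * bosonEnergy L b)) *
        Real.exp (-(v' / 2 * ∑ j ∈ s, 2 * Real.pi * (j + 1) / L)) := by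
  rw [MREdge.weight, ← Real.exp_add, ← Real.exp_add, MREdge.charge, MREdge.fermionEnergy]
  simp only [if_true]
  congr 1
  ring

lemma mrEdge_weight_untwisted (v v' L : ℝ) (r : Fin m) (n : ℤ) (b : ℕ →₀ ℕ) (s : Finset ℕ) :
    (MREdge.mk false r n b s).weight v v' L =
      Real.exp (-(Real.pi * (m * (v / (2 * L)))) * (n - (r : ℝ) / m) ^ 2) *
        Real.exp (-(v / 2 * bosonEnergy L b)) *
        Real.exp (-(v' / 2 * ∑ j ∈ s, 2 * Real.pi * (j + 1 / 2) / L)) := by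
  rw [MREdge.weight, ← Real.exp_add, ← Real.exp_add, MREdge.charge, MREdge.fermionEnergy]
  simp only [Bool.false_eq_true, if_false, add_zero]
  congr 1
  ring

lemma mrEdge_weight_sq (v v' L : ℝ) (e : MREdge m) :
    e.weight v v' L ^ 2 = e.weight (2 * v) (2 * v') L := by
  rw [MREdge.weight, MREdge.weight, ← Real.exp_nat_mul]
  congr 1
  push_cast
  ring

/-- The edge states with given boundary conditions. -/
def mrEdgeOf (t : Bool) (r : Fin m) (p : (ℤ × (ℕ →₀ ℕ)) × Finset ℕ) : MREdge m :=
  ⟨t, r, p.1.1, p.1.2, p.2⟩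

lemma hasSum_mrEdgeOf_iff (t : Bool) (r : Fin m) {f : MREdge m → ℝ} {c : ℝ}
    (hf : ∀ e, ¬ (e.twisted = t ∧ e.r = r) → f e = 0) :
    HasSum (fun p => f (mrEdgeOf t r p)) c ↔ HasSum f c := by
  have hinj : Function.Injective (mrEdgeOf t r) := by
    rintro ⟨⟨n, b⟩, s⟩ ⟨⟨n', b'⟩, s'⟩ h
    simp only [mrEdgeOf, MREdge.mk.injEq] at h
    simp [h]
  refine hinj.hasSum_iff fun e he => hf e fun h => he ⟨((e.n, e.boson), e.fermion), ?_⟩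
  rw [mrEdgeOf, ← h.1, ← h.2]

lemma negOnePow_mul_pow (n : ℤ) (k : ℕ) :
    (n.negOnePow : ℝ) * (-1) ^ k = if Even (n + (k : ℤ)) then 1 else -1 := by
  have h : (n.negOnePow : ℝ) * (-1) ^ k = ((n + (k : ℤ)).negOnePow : ℝ) := by
    rw [Int.negOnePow_add]
    push_cast
    simp [Int.negOnePow]
  rw [h]
  split_ifs with he
  · simp [Int.negOnePow_even _ he]
  · simp [Int.negOnePow_odd _ (Int.not_even_iff_odd.mp he)]

/-- The parity projection is half the full sum plus or minus half the signed one. The sign of `n + ∑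
ñ` is a product of a sign of the charge and one for each fermion, so the signed sum also factorizes.
-/
lemma hasSum_mr_weight (hm : 0 < m) {v v' L : ℝ} (hv : 0 < v) (hv' : 0 < v') (hL : 0 < L)
    (a : MRSector m) :
    HasSum (fun e : MREdge m => if e.sector = a then e.weight v v' L else 0)
      (mrSum a (v / (2 * L)) (v' / (2 * L))) := by
  have hm' : (0 : ℝ) < m := by exact_mod_cast hm
  have hy : 0 < m * (v / (2 * L)) := by positivity
  obtain ⟨l, r⟩ := a
  have hfull := hasSum_mul_prod (hasSum_mul_prod (hasSum_thetaSum ((r : ℝ) / m) hy)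
    (hasSum_boson hv hL)) (hasSum_fermionHalf hv' hL)
  have hsigned := hasSum_mul_prod (hasSum_mul_prod (hasSum_thetaSumSigned ((r : ℝ) / m) hy)
    (hasSum_boson hv hL)) (hasSum_fermionSigned hv' hL)
  have hsign : ∀ p : (ℤ × (ℕ →₀ ℕ)) × Finset ℕ,
      (p.1.1.negOnePow : ℝ) * Real.exp (-(Real.pi * (m * (v / (2 * L)))) * (p.1.1 - (r : ℝ) / m) ^ 2) *
        Real.exp (-(v / 2 * bosonEnergy L p.1.2)) * ((-1 : ℝ) ^ p.2.card *
        Real.exp (-(v' / 2 * ∑ j ∈ p.2, 2 * Real.pi * (j + 1 / 2) / L))) =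
      (if Even (mrEdgeOf false r p).parity then 1 else -1) * (mrEdgeOf false r p).weight v v' L := by
    intro p
    rw [mrEdgeOf, mrEdge_weight_untwisted, MREdge.parity, ← negOnePow_mul_pow]
    ring
  simp only [hsign] at hsigned
  have hweight : ∀ p : (ℤ × (ℕ →₀ ℕ)) × Finset ℕ,
      Real.exp (-(Real.pi * (m * (v / (2 * L)))) * (p.1.1 - (r : ℝ) / m) ^ 2) *
        Real.exp (-(v / 2 * bosonEnergy L p.1.2)) *
        Real.exp (-(v' / 2 * ∑ j ∈ p.2, 2 * Real.pi * (j + 1 / 2) / L)) =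
      (mrEdgeOf false r p).weight v v' L := by
    intro p
    rw [mrEdgeOf, mrEdge_weight_untwisted]
  simp only [hweight] at hfull
  cases l
  · rw [← hasSum_mrEdgeOf_iff false r fun e he => if_neg fun h => he ((sector_eq_one_iff e r).mp h).1]
    refine ((hfull.add hsigned).div_const 2).congr_fun fun p => ?_
    have h1 : (mrEdgeOf false r p).sector = (.one, r) ↔ Even (mrEdgeOf false r p).parity := by
      rw [sector_eq_one_iff]; simp [mrEdgeOf]
    simp only [h1]
    split_ifs <;> ring
  · rw [← hasSum_mrEdgeOf_iff false r fun e he => if_neg fun h => he ((sector_eq_chi_iff e r).mp h).1]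
    refine ((hfull.sub hsigned).div_const 2).congr_fun fun p => ?_
    have h1 : (mrEdgeOf false r p).sector = (.chi, r) ↔ ¬ Even (mrEdgeOf false r p).parity := by
      rw [sector_eq_chi_iff]; simp [mrEdgeOf]
    simp only [h1]
    split_ifs <;> ring
  · rw [← hasSum_mrEdgeOf_iff true r fun e he => if_neg fun h => he ((sector_eq_xi_iff e r).mp h)]
    refine (hasSum_mul_prod (hasSum_mul_prod (hasSum_thetaSum (((r : ℝ) + 1 / 2) / m) hy)
      (hasSum_boson hv hL)) (hasSum_fermion hv' hL)).congr_fun fun p => ?_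
    rw [if_pos ((sector_eq_xi_iff (mrEdgeOf true r p) r).mpr ⟨rfl, rfl⟩), mrEdgeOf, mrEdge_weight_twisted]

lemma mr_hasSectorSums (M : ℕ) (hm : 0 < m) {v v' L : ℝ} (hv : 0 < v) (hv' : 0 < v') (hL : 0 < L) :
    (mrGluing M m).HasSectorSums (mrAmp v v' L)
      (fun a => mrSum a (v / (2 * L)) (v' / (2 * L))) (fun a => mrSum a (v / L) (v' / L)) := by
  refine Gluing.hasSectorSums_of_weight (w := MREdge.weight v v' L) (fun e => Real.exp_pos _)
    (fun e => ?_) ?_ (hasSum_mr_weight hm hv hv' hL) fun a => ?_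
  · rw [mrAmp, norm_mul, norm_pow, Complex.norm_I, one_pow, one_mul]
    exact (Complex.norm_real _).trans (Real.norm_of_nonneg (Real.exp_pos _).le)
  · rintro ⟨l, r⟩
    cases l
    · exact ⟨⟨false, r, 0, 0, ∅⟩, (sector_eq_one_iff _ r).mpr (by simp [MREdge.parity])⟩
    · exact ⟨⟨false, r, 1, 0, ∅⟩, (sector_eq_chi_iff _ r).mpr (by simp [MREdge.parity])⟩
    · exact ⟨⟨true, r, 0, 0, ∅⟩, (sector_eq_xi_iff _ r).mpr (by simp)⟩
  · have h2 := hasSum_mr_weight hm (mul_pos two_pos hv) (mul_pos two_pos hv') hL a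
    have e : 2 * v / (2 * L) = v / L := by field_simp
    have e' : 2 * v' / (2 * L) = v' / L := by field_simp
    simp only [e, e', ← mrEdge_weight_sq] at h2
    exact h2

lemma mrDim_pos (a : MRSector m) : 0 < mrDim a := by
  obtain ⟨l, r⟩ := a
  cases l <;> simp [mrDim]

lemma totalDim_mr (m : ℕ) : totalDim (mrDim (m := m)) = Real.sqrt (4 * m) := by
  rw [totalDim]
  congr 1
  have hu : (Finset.univ : Finset IsingLabel) = {IsingLabel.one, IsingLabel.chi, IsingLabel.xi} := rfl
  rw [Fintype.sum_prod_type, hu, Finset.sum_insert (by decide), Finset.sum_insert (by decide),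
    Finset.sum_singleton]
  simp [mrDim]
  ring

/-- The signed partition sum is negligible. -/
lemma tendsto_mrSum_ratio (hm : 0 < m) {w w' : ℝ} (hw : 0 < w) (hw' : 0 < w') (r : Fin m) :
    Tendsto (fun L => mrSumSigned r (w / L) (w' / L) / mrSumFull r (w / L) (w' / L)) atTop (𝓝 0) := by
  have hm' : (0 : ℝ) < m := by exact_mod_cast hm
  -- This bounds the ratio: the signed theta sum is at most the unsigned one, the bosonic factors
  -- cancel, the signed fermion product is at most this quantity, and the unsigned one is at least
  -- `1`.
  have h1 : Tendsto (fun L => 1 - nome (w' / L / 2)) atTop (𝓝 0) := by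
    have hc : Tendsto (fun y : ℝ => 1 - nome (y / 2)) (𝓝 0) (𝓝 (1 - nome (0 / 2))) :=
      (by unfold nome; fun_prop : Continuous fun y : ℝ => 1 - nome (y / 2)).tendsto 0
    have e : 1 - nome (0 / 2) = 0 := by simp [nome]
    rw [e] at hc
    exact hc.comp ((tendsto_div_atTop_nhdsGT_zero hw').mono_right nhdsWithin_le_nhds)
  refine squeeze_zero_norm' ?_ h1
  filter_upwards [eventually_gt_atTop 0] with L hL
  have hy : 0 < w / L := div_pos hw hL
  have hy' : 0 < w' / L := div_pos hw' hL
  have hθ := thetaSum_pos ((r : ℝ) / m) (mul_pos hm' hy)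
  have hb := bosonSum_pos hy
  have hF := one_le_fermionSumHalf hy'
  have hF0 := fermionSumHalf_pos hy'
  have hS := fermionSumSigned_nonneg hy'
  have hS' := fermionSumSigned_le hy'
  have hθ' := abs_thetaSumSigned_le ((r : ℝ) / m) (mul_pos hm' hy)
  rw [Real.norm_eq_abs, mrSumSigned, mrSumFull, abs_div, abs_mul, abs_mul, abs_of_pos hb,
    abs_of_nonneg hS, abs_of_pos (by positivity : 0 < thetaSum ((r : ℝ) / m) (m * (w / L)) *
      bosonSum (w / L) * fermionSumHalf (w' / L)), div_le_iff₀ (by positivity)]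
  have h0 : 0 ≤ 1 - nome (w' / L / 2) := hS.trans hS'
  calc |thetaSumSigned ((r : ℝ) / m) (m * (w / L))| * bosonSum (w / L) * fermionSumSigned (w' / L)
      ≤ thetaSum ((r : ℝ) / m) (m * (w / L)) * bosonSum (w / L) * (1 - nome (w' / L / 2)) := by
        gcongr
    _ = (1 - nome (w' / L / 2)) * (thetaSum ((r : ℝ) / m) (m * (w / L)) * bosonSum (w / L) * 1) := by
        ring
    _ ≤ _ := by gcongr

/-- Untwisted sectors lose a factor `1 / 2` to the parity projection, while twisted ones are not
projected at the interface and lose only the `1 / √2` of the periodic fermions. Relative to `1 / (2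
√m)` this gives `1` and `√2`. -/
lemma tendsto_mrSum (hm : 0 < m) {w w' : ℝ} (hw : 0 < w) (hw' : 0 < w') (a : MRSector m) :
    Tendsto (fun L => mrSum a (w / L) (w' / L) *
      Real.exp (-((Real.pi / (12 * w) + Real.pi / (24 * w')) * L))) atTop
      (𝓝 (mrDim a / totalDim (mrDim (m := m)))) := by
  have hm' : (0 : ℝ) < m := by exact_mod_cast hm
  obtain ⟨l, r⟩ := a
  have hexp : ∀ L : ℝ, 0 < L →
      Real.exp (-((Real.pi / (12 * w) + Real.pi / (24 * w')) * L)) =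
      Real.exp (-(Real.pi / (12 * (w / L)))) * Real.exp (-(Real.pi / (24 * (w' / L)))) := by
    intro L hL
    rw [← Real.exp_add]
    congr 1
    field_simp
    ring
  have hlim := tendsto_div_atTop_nhdsGT_zero hw
  have hlim' := tendsto_div_atTop_nhdsGT_zero hw'
  have hs4 : Real.sqrt (4 * m) = 2 * Real.sqrt m := by
    rw [Real.sqrt_mul (by norm_num), show (4 : ℝ) = 2 ^ 2 by norm_num, Real.sqrt_sq (by norm_num)]
  rw [totalDim_mr, hs4]
  have hfull : Tendsto (fun L => mrSumFull r (w / L) (w' / L) *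
      Real.exp (-((Real.pi / (12 * w) + Real.pi / (24 * w')) * L))) atTop (𝓝 (Real.sqrt m)⁻¹) := by
    have h := ((tendsto_theta_mul_boson hm ((r : ℝ) / m)).comp hlim).mul
      (tendsto_fermionSumHalf.comp hlim')
    rw [mul_one] at h
    refine h.congr' ?_
    filter_upwards [eventually_gt_atTop 0] with L hL
    rw [hexp L hL, mrSumFull]
    simp only [Function.comp_apply]
    ring
  have hratio := tendsto_mrSum_ratio hm hw hw' r
  have hne : ∀ᶠ L in atTop, mrSumFull r (w / L) (w' / L) ≠ 0 := by
    filter_upwards [eventually_gt_atTop 0] with L hL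
    have hy : 0 < w / L := div_pos hw hL
    exact (mul_pos (mul_pos (thetaSum_pos _ (mul_pos hm' hy)) (bosonSum_pos hy))
      (fermionSumHalf_pos (div_pos hw' hL))).ne'
  cases l
  · have h := (hfull.mul (hratio.const_add 1)).div_const 2
    have e : (Real.sqrt m)⁻¹ * (1 + 0) / 2 = mrDim ((.one, r) : MRSector m) / (2 * Real.sqrt m) := by
      simp [mrDim]; ring
    rw [e] at h
    refine h.congr' ?_
    filter_upwards [hne] with L hL
    simp only [mrSum]
    generalize Real.exp _ = X
    field_simp
  · have h := (hfull.mul (hratio.const_sub 1)).div_const 2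
    have e : (Real.sqrt m)⁻¹ * (1 - 0) / 2 = mrDim ((.chi, r) : MRSector m) / (2 * Real.sqrt m) := by
      simp [mrDim]; ring
    rw [e] at h
    refine h.congr' ?_
    filter_upwards [hne] with L hL
    simp only [mrSum]
    generalize Real.exp _ = X
    field_simp
  · have h := ((tendsto_theta_mul_boson hm (((r : ℝ) + 1 / 2) / m)).comp hlim).mul
      (tendsto_fermionSum.comp hlim')
    have e : (Real.sqrt m)⁻¹ * (Real.sqrt 2)⁻¹ = mrDim ((.xi, r) : MRSector m) / (2 * Real.sqrt m) := by
      have h1 := (Real.sqrt_pos.mpr hm').ne'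
      have h2 : Real.sqrt 2 ≠ 0 := by positivity
      have h3 : Real.sqrt 2 * Real.sqrt 2 = 2 := Real.mul_self_sqrt zero_le_two
      simp only [mrDim]
      field_simp
      linarith
    rw [e] at h
    refine h.congr' ?_
    filter_upwards [eventually_gt_atTop 0] with L hL
    rw [hexp L hL]
    simp only [mrSum, mrSumTwisted, Function.comp_apply]
    ring

lemma tendsto_mr_ratio (hm : 0 < m) {v v' : ℝ} (hv : 0 < v) (hv' : 0 < v') (a : MRSector m) :
    Tendsto (fun L => mrSum a (v / (2 * L)) (v' / (2 * L)) ^ 2 / mrSum a (v / L) (v' / L) *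
      Real.exp (-(Real.pi / 2 * (1 / v + 1 / (2 * v')) / 2 * L))) atTop
      (𝓝 (mrDim a / totalDim (mrDim (m := m)))) := by
  have : Nonempty (MRSector m) := ⟨a⟩
  have h1 := tendsto_mrSum hm (half_pos hv) (half_pos hv') a
  have h2 := tendsto_mrSum hm hv hv' a
  have e1 : Real.pi / (12 * (v / 2)) + Real.pi / (24 * (v' / 2)) =
      2 * (Real.pi / (12 * v) + Real.pi / (24 * v')) := by field_simp
  have e2 : Real.pi / 2 * (1 / v + 1 / (2 * v')) / 2 =
      3 * (Real.pi / (12 * v) + Real.pi / (24 * v')) := by field_simp; ring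
  rw [e1] at h1
  simp only [div_div] at h1
  rw [e2]
  exact tendsto_sq_div (div_pos (mrDim_pos a) (totalDim_pos mrDim_pos)) h1 h2

theorem mr_formulas (hm : 0 < m) (M : ℕ) [NeZero M] {v v' : ℝ} (hv : 0 < v) (hv' : 0 < v')
    {ψ : MRSector m → ℂ} (hψ : ∑ a, ‖ψ a‖ ^ 2 = 1) :
    (∀ L > 0, HasSum (fun X => ‖mrState M v v' L ψ X‖ ^ 2) 1) ∧
      TorusFormula M mrDim ψ (Real.pi / 2 * (1 / v + 1 / (2 * v')))
        (fun L => mrState M v v' L ψ) ∧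
      ∀ S : Finset (ZMod (2 * M)), S.Nonempty →
        CylinderFormula M mrDim ψ (Real.pi / 2 * (1 / v + 1 / (2 * v')))
          (fun L => mrState M v v' L ψ) S := by
  have hfam := fun L (_ : L > 0) => mr_isSectorFamily (m := m) M v v' L
  have hsums := fun L (hL : L > 0) => mr_hasSectorSums (m := m) M hm hv hv' hL
  exact ⟨fun L hL => (hfam L hL).hasSum_norm_sq (hsums L hL) hψ,
    Gluing.torusFormula hfam hsums mrDim_pos (tendsto_mr_ratio hm hv hv') hψ,
    fun S hS => Gluing.cylinderFormula hfam hsums mrDim_pos (tendsto_mr_ratio hm hv hv') hψ hS⟩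

end MooreReadSums

end CutGlue

end

open CutGlue in
theorem mainTheorem3 (m : ℕ) (hm : 0 < m) (M : ℕ) [NeZero M]
    (v v' : ℝ) (hv : 0 < v) (hv' : 0 < v') :
    (totalDim (laughlinDim (m := m)) = Real.sqrt m ∧
      ∀ ψ : Fin m → ℂ, ∑ a, ‖ψ a‖ ^ 2 = 1 →
        (∀ L > 0, HasSum (fun X => ‖laughlinState M v L ψ X‖ ^ 2) 1) ∧
        TorusFormula M laughlinDim ψ (Real.pi / (2 * v)) (fun L => laughlinState M v L ψ) ∧
        ∀ S : Finset (ZMod (2 * M)), S.Nonempty → S.card ≤ M →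
          CylinderFormula M laughlinDim ψ (Real.pi / (2 * v))
            (fun L => laughlinState M v L ψ) S) ∧
    (totalDim (mrDim (m := m)) = Real.sqrt (4 * m) ∧
      ∀ ψ : MRSector m → ℂ, ∑ a, ‖ψ a‖ ^ 2 = 1 →
        (∀ L > 0, HasSum (fun X => ‖mrState M v v' L ψ X‖ ^ 2) 1) ∧
        TorusFormula M mrDim ψ (Real.pi / 2 * (1 / v + 1 / (2 * v')))
          (fun L => mrState M v v' L ψ) ∧
        ∀ S : Finset (ZMod (2 * M)), S.Nonempty → S.card ≤ M →
          CylinderFormula M mrDim ψ (Real.pi / 2 * (1 / v + 1 / (2 * v')))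
            (fun L => mrState M v v' L ψ) S) := by
  exact ⟨⟨totalDim_laughlin m, fun ψ hψ =>
      have h := laughlin_formulas hm M hv hψ
      ⟨h.1, h.2.1, fun S hS _ => h.2.2 S hS⟩⟩,
    totalDim_mr m, fun ψ hψ =>
      have h := mr_formulas hm M hv hv' hψ
      ⟨h.1, h.2.1, fun S hS _ => h.2.2 S hS⟩⟩
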